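/- Let $\Omega\subset\mathbb{C}$ be a bounded $m$-connected planar region with $m\ge 3$, i.e. a bounded, connected, open set whose complement has exactly $m$ connected components. Write $\partial\Omega=E_1\sqcup E_2$, where $E_1$ is the outermost boundary component (the boundary points lying in the unbounded component of $\mathbb{C}\setminus\Omega$) and $E_2=E_2^1\sqcup\dots\sqcup E_2^{m-1}$ is the union of the inner boundary components. Let $\mathcal{T}$ be a finite cellular decomposition of $\Omega\cup\partial\Omega$, with $\partial\Omega$ a subcomplex, with simple $1$-skeleton, and with every $2$-cell a triangle or a quadrilateral, endowed with an affine structure: every closed $2$-cell is identified with a Euclidean triangle or a strictly convex Euclidean quadrilateral, and the identifications agree affinely along common edges. Let $c(x,y)=c(y,x)>0$ be a conductance function on the edges, let $k>0$, and let $g:\mathcal{T}^{(0)}\to\mathbb{R}$ be the solution of the Dirichlet problem $$g|_{E_1}=k,\qquad g|_{E_2}=0,\qquad \sum_{y\sim x}c(x,y)\,(g(x)-g(y))=0\quad\text{for every vertex } x\in\Omega .$$ Assume that the two endpoints of every edge not contained in $\partial\Omega$ have different $g$-values, and that $g$ extends to a function $\bar g$ on $\Omega\cup\partial\Omega$ which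 is affine on every $2$-cell (for triangles this is automatic). For a vertex $v\in\Omega$ with neighbors $w_1,\dots,w_d$ in cyclic order around $v$, let $\mathrm{Sgc}_g(v)$ be the number of sign changes in the sequence $g(w_1)-g(v),\dots,g(w_d)-g(v),g(w_1)-g(v)$; the vertex $v$ is called singular if $\mathrm{Ind}_g(v)=1-\tfrac12\mathrm{Sgc}_g(v)\neq 0$. A level curve is a connected component of a level set of $\bar g$ in $\Omega\cup\partial\Omega$; it is singular if it contains a singular vertex. The domain bounded by a level curve $L$ is the union of the bounded connected components of $\mathbb{C}\setminus L$. Then there exists exactly one singular level curve $L$ such that all the inner boundary components $E_2^1,\dots,E_2^{m-1}$ are contained in the domain bounded by $L$. -/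

import Mathlib

open Set

/-- `Ω` is a bounded `m`-connected region of the plane: a bounded, open, connected (non-empty) set
whose complement has exactly `m` connected components (one of them unbounded). -/
structure IsMConnectedRegion (Ω : Set ℂ) (m : ℕ) : Prop where
  isOpen : IsOpen Ω
  isConnected : IsConnected Ω
  isBounded : Bornology.IsBounded Ω
  card_components : Nat.card (ConnectedComponents ↥(Ωᶜ)) = m

/-- The outermost boundary component `E₁`: the boundary points of `Ω` which lie in the unbounded
component of the complement of `Ω`. -/
def outerBoundary (Ω : Set ℂ) : Set ℂ :=
  {z ∈ frontier Ω | ¬ Bornology.IsBounded (connectedComponentIn Ωᶜ z)}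

/-- The union `E₂` of the inner boundary components: the boundary points of `Ω` which lie in a
bounded component of the complement of `Ω`. (Each bounded component of the complement contributes
one inner boundary component.) -/
def innerBoundary (Ω : Set ℂ) : Set ℂ :=
  {z ∈ frontier Ω | Bornology.IsBounded (connectedComponentIn Ωᶜ z)}

/-- The domain bounded by a closed curve `L`: the union of the bounded components of its
complement. -/
def enclosedDomain (L : Set ℂ) : Set ℂ :=
  {z | z ∉ L ∧ Bornology.IsBounded (connectedComponentIn Lᶜ z)}

/-- `p 0, p 1, …, p (n - 1)` are the consecutive corners, counterclockwise, of a non-degenerate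
strictly convex `n`-gon: every corner not on a given side lies strictly to the left of it
(the imaginary part of `conj a * b` is the cross product of `a` and `b`). -/
def IsConvexPolygon {n : ℕ} (p : Fin n → ℂ) : Prop :=
  ∀ i j, j ≠ i → j ≠ finRotate n i →
    0 < ((starRingEnd ℂ) (p (finRotate n i) - p i) * (p j - p i)).im

/-- A finite cellular decomposition of `Ω ∪ ∂Ω` all of whose `2`-cells are triangles or
quadrilaterals, with its affine structure: each (possibly curved) closed `2`-cell is parametrized
by a Euclidean triangle or convex quadrilateral, and these parametrizations restrict on the sides
to affine parametrizations of the (possibly curved) edges. -/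
structure CellDecomposition (Ω : Set ℂ) where
  /-- the vertices -/
  V : Finset ℂ
  /-- the `1`-skeleton, a simple graph -/
  graph : SimpleGraph V
  /-- `arc u v` on `[0, 1]` parametrizes the edge from `u` to `v` -/
  arc : V → V → ℝ → ℂ
  arc_continuousOn : ∀ u v, graph.Adj u v → ContinuousOn (arc u v) (Icc 0 1)
  arc_injOn : ∀ u v, graph.Adj u v → InjOn (arc u v) (Icc 0 1)
  arc_zero : ∀ u v, graph.Adj u v → arc u v 0 = u
  arc_one : ∀ u v, graph.Adj u v → arc u v 1 = v
  arc_symm : ∀ u v, graph.Adj u v → ∀ t ∈ Icc (0 : ℝ) 1, arc v u t = arc u v (1 - t)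
  /-- the `2`-cells -/
  F : Type
  finite_F : Finite F
  /-- the number of sides of a `2`-cell -/
  sides : F → ℕ
  sides_eq : ∀ f, sides f = 3 ∨ sides f = 4
  /-- the corners of the model polygon of a `2`-cell -/
  corner : (f : F) → Fin (sides f) → ℂ
  corner_convex : ∀ f, IsConvexPolygon (corner f)
  /-- the vertices of a `2`-cell, in cyclic order -/
  vtx : (f : F) → Fin (sides f) → V
  /-- the parametrization of a closed `2`-cell by its model polygon -/
  chart : F → ℂ → ℂ
  chart_continuousOn : ∀ f, ContinuousOn (chart f) (convexHull ℝ (range (corner f)))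
  chart_injOn : ∀ f, InjOn (chart f) (convexHull ℝ (range (corner f)))
  side_adj : ∀ f i, graph.Adj (vtx f i) (vtx f (finRotate _ i))
  chart_side : ∀ f i, ∀ t ∈ Icc (0 : ℝ) 1,
    chart f (AffineMap.lineMap (corner f i) (corner f (finRotate _ i)) t) =
      arc (vtx f i) (vtx f (finRotate _ i)) t
  -- the open cells are pairwise disjoint
  vertex_notMem_edge : ∀ (w : V) (u v), graph.Adj u v → (w : ℂ) ∉ arc u v '' Ioo 0 1
  vertex_notMem_face : ∀ (w : V) (f), (w : ℂ) ∉ chart f '' interior (convexHull ℝ (range (corner f)))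
  edge_disjoint_edge : ∀ u v u' v', graph.Adj u v → graph.Adj u' v' → s(u, v) ≠ s(u', v') →
    Disjoint (arc u v '' Ioo 0 1) (arc u' v' '' Ioo 0 1)
  edge_disjoint_face : ∀ u v f, graph.Adj u v →
    Disjoint (arc u v '' Ioo 0 1) (chart f '' interior (convexHull ℝ (range (corner f))))
  face_disjoint_face : ∀ f f', f ≠ f' →
    Disjoint (chart f '' interior (convexHull ℝ (range (corner f))))
      (chart f' '' interior (convexHull ℝ (range (corner f'))))
  -- the cells fill `Ω ∪ ∂Ω`, and `∂Ω` is a subcomplex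
  vertex_mem : ∀ w : V, (w : ℂ) ∈ closure Ω
  edge_subset : ∀ u v, graph.Adj u v → arc u v '' Ioo 0 1 ⊆ Ω ∨ arc u v '' Ioo 0 1 ⊆ frontier Ω
  face_subset : ∀ f, chart f '' interior (convexHull ℝ (range (corner f))) ⊆ Ω
  covers : closure Ω ⊆ ⋃ f, chart f '' convexHull ℝ (range (corner f))
  /-- the number of neighbors of a vertex (only relevant at vertices in `Ω`) -/
  deg : V → ℕ
  /-- the neighbors of a vertex of `Ω`, enumerated in the cyclic order around it -/
  nbr : (v : V) → Fin (deg v) → V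
  /-- `sector v i` is the `2`-cell at `v` between the neighbors number `i` and `i + 1` -/
  sector : (v : V) → Fin (deg v) → F
  nbr_bijOn : ∀ v : V, (v : ℂ) ∈ Ω → BijOn (nbr v) univ {w | graph.Adj v w}
  sector_bijOn : ∀ v : V, (v : ℂ) ∈ Ω → BijOn (sector v) univ {f | v ∈ range (vtx f)}
  sector_sides : ∀ v : V, (v : ℂ) ∈ Ω → ∀ i, ∃ j, vtx (sector v i) j = v ∧
    ({vtx (sector v i) ((finRotate _).symm j), vtx (sector v i) (finRotate _ j)} : Set V) =
      {nbr v i, nbr v (finRotate _ i)}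

namespace CellDecomposition

variable {Ω : Set ℂ} (T : CellDecomposition Ω)

/-- A conductance function: symmetric and positive on the edges. -/
def IsConductance (c : T.V → T.V → ℝ) : Prop :=
  ∀ u v, T.graph.Adj u v → 0 < c u v ∧ c u v = c v u

open scoped Classical in
/-- The combinatorial Laplacian `Δ u (x) = ∑_{y ∼ x} c(x, y) (u(x) - u(y))`. -/
noncomputable def laplacian (c : T.V → T.V → ℝ) (u : T.V → ℝ) (x : T.V) : ℝ :=
  ∑ y with T.graph.Adj x y, c x y * (u x - u y)

/-- `g` solves the Dirichlet boundary value problem: it is harmonic at every vertex in `Ω`, equals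
`k` on the outer boundary component and `0` on the inner ones. -/
structure IsDirichletSolution (c : T.V → T.V → ℝ) (k : ℝ) (g : T.V → ℝ) : Prop where
  harmonic : ∀ x : T.V, (x : ℂ) ∈ Ω → T.laplacian c g x = 0
  outer : ∀ x : T.V, (x : ℂ) ∈ outerBoundary Ω → g x = k
  inner : ∀ x : T.V, (x : ℂ) ∈ innerBoundary Ω → g x = 0

/-- Adjacent vertices have different values, except along the edges contained in `∂Ω`, where the
Dirichlet condition forces equal values. -/
def SeparatesAdjacent (g : T.V → ℝ) : Prop :=
  ∀ u v, T.graph.Adj u v → T.arc u v '' Ioo 0 1 ⊆ Ω → g u ≠ g v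

/-- `gbar` extends `g` and is affine on every `2`-cell (hence on every edge). -/
structure IsAffineExtension (g : T.V → ℝ) (gbar : ℂ → ℝ) : Prop where
  vertex : ∀ v : T.V, gbar v = g v
  affine : ∀ f, ∃ A : ℂ →ᵃ[ℝ] ℝ, ∀ z ∈ convexHull ℝ (range (T.corner f)), gbar (T.chart f z) = A z

open scoped Classical in
/-- The number `Sgc_g(v)` of sign changes in the cyclic sequence `g(w₁) - g(v), …, g(w_d) - g(v)`,
where `w₁, …, w_d` are the neighbors of `v` in cyclic order. -/
noncomputable def signChanges (g : T.V → ℝ) (v : T.V) : ℕ :=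
  Fintype.card {i : Fin (T.deg v) //
    (g (T.nbr v i) - g v) * (g (T.nbr v (finRotate _ i)) - g v) < 0}

/-- The index `1 - Sgc_g(v) / 2`. -/
noncomputable def index (g : T.V → ℝ) (v : T.V) : ℝ :=
  1 - (T.signChanges g v : ℝ) / 2

/-- A singular vertex: a vertex in the interior `Ω` with non-zero index. -/
def IsSingularVertex (g : T.V → ℝ) (v : T.V) : Prop :=
  (v : ℂ) ∈ Ω ∧ T.index g v ≠ 0

/-- A level curve: a connected component of a level set of the affine extension on `Ω ∪ ∂Ω`. It is
singular if it contains a singular vertex. -/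
def IsSingularLevelCurve (g : T.V → ℝ) (gbar : ℂ → ℝ) (L : Set ℂ) : Prop :=
  (∃ z ∈ closure Ω, L = connectedComponentIn {w ∈ closure Ω | gbar w = gbar z} z) ∧
    ∃ v : T.V, T.IsSingularVertex g v ∧ (v : ℂ) ∈ L

end CellDecomposition

/-! Extend `gbar` to a continuous function `G` on the plane, equal to `0` on the bounded components
of the complement (the holes) and to `k` on the unbounded one. Harmonicity and distinct values along
interior edges give every vertex of `Ω` a higher and a lower neighbor. This yields a maximum
principle: for `0 < t < k` the set `{G > t}` is connected, since each of its points is linked to the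
outside, and every component of `{G < t}` reaches a hole.

Since `m ≥ 3`, the set of holes `{G ≤ 0}` is disconnected, while `{G < k} = Ω ∪ holes` is connected.
Let `t` be the infimum of the levels with connected open sublevel set (`exists_critical_level`).
Then `{G < t}` is disconnected, and `{G ≤ s}` is connected for `t ≤ s < k`. The plane is unicoherent
(`isPreconnected_inter_of_union_eq_univ`), so `{G = t} = {G ≤ t} ∩ {G ≥ t}` is connected: it is a
single level curve, and it encloses all holes because they lie in the bounded set `{G < t}`. Without
a singular vertex on it, `{G < t}` would be locally linked near each of its points
(`eventually_linkedIn`), and propagation along the curve would make `{G < t}` connected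
(`exists_not_locally_linked`).

For uniqueness, a level curve below `t` misses some component of `{G < t}`; this component contains
inner boundary points and is adherent to `{G ≥ t}`, so these points are joined to infinity off the
curve. At a level strictly between `t` and `k` there is no singular vertex at all
(`not_isSingularVertex`): two descending edges from different descending runs, together with a
connected sublevel set, would separate the plane by `not_isPreconnected_compl_union`, but the
connected superlevel set makes the complement connected. -/

open Filter Topology

/-! ### Planar topology -/

/-- Two continuous logarithms of the same function on a preconnected set differ by a constant. -/
theorem exists_const_of_exp_eq {X : Type*} [TopologicalSpace X] {s : Set X} (hs : IsPreconnected s)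
    {h₁ h₂ : X → ℂ} (c₁ : ContinuousOn h₁ s) (c₂ : ContinuousOn h₂ s)
    (he : ∀ z ∈ s, Complex.exp (h₁ z) = Complex.exp (h₂ z)) :
    ∃ c : ℂ, Complex.exp c = 1 ∧ ∀ z ∈ s, h₁ z = h₂ z + c := by
  rcases s.eq_empty_or_nonempty with rfl | ⟨x₀, hx₀⟩
  · exact ⟨0, by simp, by simp⟩
  have hmul : ∀ z ∈ s, Complex.exp (h₁ z - h₂ z) = 1 := fun z hz => by
    rw [Complex.exp_sub, he z hz, div_self (Complex.exp_ne_zero _)]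
  -- The difference has values in the discrete set `2πiℤ`, so it is locally constant.
  have key : ∀ x ∈ s, ∀ y ∈ s, h₁ x - h₂ x = h₁ y - h₂ y := by
    intro x hx y hy
    refine hs.induction₂ (fun x y => h₁ x - h₂ x = h₁ y - h₂ y) ?_
      (fun _ _ _ _ _ _ h h' => h.trans h') (fun _ _ _ _ h => h.symm) hx hy
    intro x hx
    have hc := (c₁.sub c₂) x hx
    have hev := (Metric.tendsto_nhds.1 hc) 1 one_pos
    filter_upwards [hev, self_mem_nhdsWithin] with y hy hys
    obtain ⟨n, hn⟩ := Complex.exp_eq_one_iff.1 (hmul x hx)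
    obtain ⟨l, hl⟩ := Complex.exp_eq_one_iff.1 (hmul y hys)
    simp only [Pi.sub_apply] at hy
    rw [dist_eq_norm, hn, hl, ← sub_mul, norm_mul] at hy
    have h2 : (1 : ℝ) ≤ ‖(2 * Real.pi * Complex.I : ℂ)‖ := by
      simp only [norm_mul, Complex.norm_I, Complex.norm_ofNat, Complex.norm_real, mul_one,
        Real.norm_eq_abs, abs_of_pos Real.pi_pos]
      linarith [Real.pi_gt_three]
    have h3 : ‖((l : ℂ) - n)‖ < 1 := by nlinarith [norm_nonneg ((l : ℂ) - n)]
    have h4 : l - n = 0 := by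
      rw [← Int.abs_lt_one_iff]
      have : ‖((l - n : ℤ) : ℂ)‖ < 1 := by push_cast; exact h3
      rw [Complex.norm_intCast] at this
      exact_mod_cast this
    rw [hn, hl, sub_eq_zero.1 h4]
  refine ⟨h₁ x₀ - h₂ x₀, hmul x₀ hx₀, fun z hz => ?_⟩
  rw [key x₀ hx₀ z hz]; ring

/-- A nowhere vanishing continuous function on the plane has a continuous logarithm. -/
theorem exists_continuous_log {f : ℂ → ℂ} (hf : Continuous f) (h0 : ∀ z, f z ≠ 0) :
    ∃ h : ℂ → ℂ, Continuous h ∧ ∀ z, Complex.exp (h z) = f z := by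
  -- `exp` is a covering of `ℂ \ {0}`, so `f` lifts from the simply connected plane.
  have hsc : SimplyConnectedSpace ℂ := inferInstance
  obtain ⟨F, ⟨-, hF⟩, -⟩ := Complex.isCoveringMapOn_exp.existsUnique_continuousMap_lifts
    (⟨f, hf⟩ : C(ℂ, ℂ)) (a₀ := 0) (e₀ := Complex.log (f 0)) (by simpa using Complex.exp_log (h0 0))
    (fun a => by simpa using h0 a)
  exact ⟨F, F.continuous, fun z => congrFun hF z⟩

/-- The plane is unicoherent. -/
theorem isPreconnected_inter_of_union_eq_univ {A B : Set ℂ} (hA : IsClosed A) (hB : IsClosed B)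
    (cA : IsPreconnected A) (cB : IsPreconnected B) (hAB : A ∪ B = univ) :
    IsPreconnected (A ∩ B) := by
  classical
  rw [isPreconnected_closed_iff]
  intro t t' ht ht' hcov hn hn'
  by_contra hemp
  rw [not_nonempty_iff_eq_empty] at hemp
  obtain ⟨x, hxAB, hxt⟩ := hn
  obtain ⟨y, hyAB, hyt⟩ := hn'
  have hd : Disjoint (A ∩ B ∩ t) (A ∩ B ∩ t') := by
    rw [Set.disjoint_iff]
    rintro z ⟨⟨h1, h2⟩, -, h3⟩
    have : z ∈ A ∩ B ∩ (t ∩ t') := ⟨h1, h2, h3⟩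
    rw [hemp] at this
    exact this
  obtain ⟨u, hu0, hu1, -⟩ := exists_continuous_zero_one_of_isClosed
    ((hA.inter hB).inter ht) ((hA.inter hB).inter ht') hd
  -- The functions `exp (iπu)` on `A` and `exp (-iπu)` on `B` agree where `u` is `0` or `1`, hence
  -- glue. A global logarithm equals `iπu + c` on `A` and `-iπu + d` on `B`; comparison at `x` gives
  -- `c = d`, and at `y` it gives `2πi = 0`.
  let e₁ : ℂ → ℂ := fun z => Real.pi * u z * Complex.I
  have ce₁ : Continuous e₁ := by fun_prop
  have hAB' : ∀ z, z ∈ A → z ∈ B → Complex.exp (e₁ z) = Complex.exp (-e₁ z) := by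
    intro z hzA hzB
    rcases hcov ⟨hzA, hzB⟩ with h | h
    · have : u z = 0 := hu0 ⟨⟨hzA, hzB⟩, h⟩
      simp [e₁, this]
    · have : u z = 1 := hu1 ⟨⟨hzA, hzB⟩, h⟩
      simp [e₁, this, Complex.exp_neg, Complex.exp_pi_mul_I]
  let f : ℂ → ℂ := fun z => if z ∈ A then Complex.exp (e₁ z) else Complex.exp (-e₁ z)
  have fA : ∀ z ∈ A, f z = Complex.exp (e₁ z) := fun z hz => if_pos hz
  have fB : ∀ z ∈ B, f z = Complex.exp (-e₁ z) := fun z hz => by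
    by_cases h : z ∈ A
    · rw [fA z h, hAB' z h hz]
    · exact if_neg h
  have hf : Continuous f := by
    rw [← continuousOn_univ, ← hAB]
    refine ContinuousOn.union_of_isClosed ?_ ?_ hA hB
    · exact (Complex.continuous_exp.comp ce₁).continuousOn.congr fA
    · exact (Complex.continuous_exp.comp ce₁.neg).continuousOn.congr fB
  obtain ⟨h, ch, eh⟩ := exists_continuous_log hf (fun z => by
    simp only [f]; split_ifs <;> exact Complex.exp_ne_zero _)
  obtain ⟨c, -, hc⟩ := exists_const_of_exp_eq cA ch.continuousOn ce₁.continuousOn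
    (fun z hz => by rw [eh, fA z hz])
  obtain ⟨d, -, hd⟩ := exists_const_of_exp_eq cB ch.continuousOn ce₁.neg.continuousOn
    (fun z hz => by rw [eh, fB z hz]; rfl)
  have ux : u x = 0 := hu0 ⟨hxAB, hxt⟩
  have uy : u y = 1 := hu1 ⟨hyAB, hyt⟩
  have x1 := (hc x hxAB.1).symm.trans (hd x hxAB.2)
  have y1 := (hc y hyAB.1).symm.trans (hd y hyAB.2)
  simp only [e₁, ux, uy, Complex.ofReal_zero, Complex.ofReal_one, mul_zero, zero_mul, neg_zero,
    zero_add, mul_one, Pi.neg_apply] at x1 y1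
  rw [x1] at y1
  have y2 : (2 * (Real.pi * Complex.I) : ℂ) = 0 := by linear_combination y1
  simp [Real.pi_ne_zero] at y2

/-- If all the slightly larger open sublevel sets are connected, so is a compact sublevel set. -/
theorem isPreconnected_sublevel {G : ℂ → ℝ} (hG : Continuous G) {t t₁ : ℝ} (ht : t < t₁)
    (hcpt : IsCompact {z | G z ≤ t₁}) (hpre : ∀ s, t < s → s < t₁ → IsPreconnected {z | G z < s}) :
    IsPreconnected {z | G z ≤ t} := by
  rw [isPreconnected_closed_iff]
  intro T T' hT hT' hcov hn hn'
  by_contra hemp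
  rw [not_nonempty_iff_eq_empty] at hemp
  have hc : IsCompact {z | G z ≤ t} :=
    hcpt.of_isClosed_subset (isClosed_le hG continuous_const) (fun z hz => le_trans hz ht.le)
  have hdis : Disjoint ({z | G z ≤ t} ∩ T) ({z | G z ≤ t} ∩ T') := by
    rw [Set.disjoint_iff]
    rintro z ⟨⟨h1, h2⟩, -, h3⟩
    have : z ∈ {z | G z ≤ t} ∩ (T ∩ T') := ⟨h1, h2, h3⟩
    rw [hemp] at this
    exact this
  obtain ⟨U, V, hU, hV, hPU, hQV, hUV⟩ := SeparatedNhds.of_isCompact_isCompact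
    (hc.inter_right hT) (hc.inter_right hT') hdis
  -- On this compact set `G` exceeds `t` by a positive gap, so `{G < s}` is still inside `U ∪ V` for
  -- `s` close to `t`.
  have hK : IsCompact ({z | G z ≤ t₁} \ (U ∪ V)) := hcpt.diff (hU.union hV)
  have hKt : ∀ z ∈ {z | G z ≤ t₁} \ (U ∪ V), t < G z := by
    intro z hz
    by_contra h
    push Not at h
    rcases hcov h with h' | h'
    · exact hz.2 (Or.inl (hPU ⟨h, h'⟩))
    · exact hz.2 (Or.inr (hQV ⟨h, h'⟩))
  obtain ⟨s, hs1, hs2, hs3⟩ : ∃ s, t < s ∧ s < t₁ ∧ {z | G z < s} ⊆ U ∪ V := by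
    rcases ({z | G z ≤ t₁} \ (U ∪ V)).eq_empty_or_nonempty with he | hne
    · obtain ⟨s, h1, h2⟩ := exists_between ht
      refine ⟨s, h1, h2, fun z hz => ?_⟩
      by_contra h
      have : z ∈ {z | G z ≤ t₁} \ (U ∪ V) := ⟨(lt_trans hz h2).le, h⟩
      rw [he] at this
      exact this
    · obtain ⟨z₀, hz₀, hmin⟩ := hK.exists_isMinOn hne hG.continuousOn
      obtain ⟨s, h1, h2⟩ := exists_between (lt_min ht (hKt z₀ hz₀))
      refine ⟨s, h1, h2.trans_le (min_le_left _ _), fun z hz => ?_⟩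
      by_contra h
      have hz1 : G z < s := hz
      have := hmin (show z ∈ {z | G z ≤ t₁} \ (U ∪ V) from
        ⟨(hz1.trans (h2.trans_le (min_le_left _ _))).le, h⟩)
      have h3 : G z₀ ≤ G z := this
      have := h2.trans_le (min_le_right _ _)
      linarith
  obtain ⟨x, hx, hxT⟩ := hn
  obtain ⟨y, hy, hyT⟩ := hn'
  obtain ⟨w, -, hw⟩ := hpre s hs1 hs2 U V hU hV hs3
    ⟨x, lt_of_le_of_lt hx hs1, hPU ⟨hx, hxT⟩⟩ ⟨y, lt_of_le_of_lt hy hs1, hQV ⟨hy, hyT⟩⟩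
  exact Set.disjoint_iff.1 hUV hw

/-- A compact subset of an open connected set lies in a compact connected subset. -/
theorem exists_isCompact_isPreconnected_between {W C : Set ℂ} (hW : IsOpen W)
    (cW : IsPreconnected W) (hC : IsCompact C) (hCW : C ⊆ W) :
    ∃ C', IsCompact C' ∧ IsPreconnected C' ∧ C ⊆ C' ∧ C' ⊆ W := by
  rcases W.eq_empty_or_nonempty with rfl | ⟨x₀, hx₀⟩
  · exact ⟨∅, isCompact_empty, isPreconnected_empty, hCW, le_rfl⟩
  have hp : IsPathConnected W := (IsOpen.isConnected_iff_isPathConnected hW).1 ⟨⟨x₀, hx₀⟩, cW⟩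
  -- The common base point keeps unions connected in the compactness induction.
  suffices h : ∃ C', IsCompact C' ∧ IsPreconnected C' ∧ x₀ ∈ C' ∧ C ⊆ C' ∧ C' ⊆ W by
    obtain ⟨C', h1, h2, -, h3, h4⟩ := h
    exact ⟨C', h1, h2, h3, h4⟩
  refine hC.induction_on (p := fun C => ∃ C', IsCompact C' ∧ IsPreconnected C' ∧ x₀ ∈ C' ∧
    C ⊆ C' ∧ C' ⊆ W) ?_ ?_ ?_ ?_
  · exact ⟨{x₀}, isCompact_singleton, isPreconnected_singleton, rfl, empty_subset _,
      singleton_subset_iff.2 hx₀⟩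
  · rintro s t hst ⟨C', h1, h2, h3, h4, h5⟩
    exact ⟨C', h1, h2, h3, hst.trans h4, h5⟩
  · rintro s t ⟨C₁, h1, h2, h3, h4, h5⟩ ⟨C₂, h1', h2', h3', h4', h5'⟩
    exact ⟨C₁ ∪ C₂, h1.union h1', h2.union x₀ h3 h3' h2', Or.inl h3, union_subset_union h4 h4',
      union_subset h5 h5'⟩
  · intro x hx
    obtain ⟨r, hr, hball⟩ := Metric.nhds_basis_closedBall.mem_iff.1 (hW.mem_nhds (hCW hx))
    obtain ⟨γ, hγ⟩ := hp.joinedIn x₀ hx₀ x (hCW hx)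
    refine ⟨Metric.closedBall x r, mem_nhdsWithin_of_mem_nhds (Metric.closedBall_mem_nhds x hr),
      range γ ∪ Metric.closedBall x r, (isCompact_range γ.continuous).union
        (isCompact_closedBall x r), ?_, Or.inl ⟨0, γ.source⟩, subset_union_right,
      union_subset (range_subset_iff.2 hγ) hball⟩
    exact (isPreconnected_range γ.continuous).union x ⟨1, γ.target⟩
      (Metric.mem_closedBall_self hr.le) Metric.isPreconnected_closedBall

/-- There is no continuous logarithm of `z - p` on a circle around `p`. -/
theorem not_exists_log_on_sphere {p : ℂ} {r : ℝ} (hr : 0 < r) {h : ℂ → ℂ}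
    (hc : ContinuousOn h (Metric.sphere p r))
    (he : ∀ z ∈ Metric.sphere p r, Complex.exp (h z) = z - p) : False := by
  have hmem : ∀ θ : ℝ, p + r * Complex.exp (θ * Complex.I) ∈ Metric.sphere p r := fun θ => by
    simp [Complex.norm_exp_ofReal_mul_I, abs_of_pos hr]
  -- Along the circle a logarithm must be `log r + iθ` up to a constant, which does not return to
  -- its value after a full turn.
  obtain ⟨c, -, hc'⟩ := exists_const_of_exp_eq (s := (univ : Set ℝ)) isPreconnected_univ
    (h₁ := fun θ : ℝ => h (p + r * Complex.exp (θ * Complex.I)))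
    (h₂ := fun θ : ℝ => Complex.log r + θ * Complex.I)
    (hc.comp (by fun_prop) (fun θ _ => hmem θ)) (by fun_prop)
    (fun θ _ => by
      rw [he _ (hmem θ), Complex.exp_add, Complex.exp_log (by exact_mod_cast hr.ne')]; ring)
  have h0 := hc' 0 trivial
  have h1 := hc' (2 * Real.pi) trivial
  simp only [Complex.ofReal_zero, zero_mul, Complex.exp_zero] at h0
  simp only [Complex.ofReal_mul, Complex.ofReal_ofNat, Complex.exp_two_pi_mul_I] at h1
  rw [h0] at h1
  have : (2 * Real.pi * Complex.I : ℂ) = 0 := by linear_combination -h1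
  simp [Real.pi_ne_zero] at this

/-- Away from a connected set containing `p` and `q`, the function `(z - p) / (z - q)` has a
continuous logarithm. -/
theorem exists_log_div_of_isPreconnected {X : Set ℂ} (cX : IsPreconnected X) {p q : ℂ} (hp : p ∈ X)
    (hq : q ∈ X) {δ : ℝ} (hδ : 0 < δ) :
    ∃ h : ℂ → ℂ, ContinuousOn h {z | δ ≤ Metric.infDist z X} ∧
      ∀ z ∈ {z | δ ≤ Metric.infDist z X}, Complex.exp (h z) = (z - p) / (z - q) := by
  have hne : ∀ x ∈ X, ∀ z ∈ {z | δ ≤ Metric.infDist z X}, z - x ≠ 0 := by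
    intro x hx z hz h
    rw [sub_eq_zero] at h
    have : Metric.infDist z X = 0 := by rw [h]; exact Metric.infDist_zero_of_mem hx
    have h2 : δ ≤ Metric.infDist z X := hz
    linarith
  -- Having such a logarithm is an equivalence relation between points of `X`. It holds for points
  -- closer than `δ`, where the quotient stays within distance `1` of `1`.
  refine cX.induction₂ (fun p q => ∃ h : ℂ → ℂ, ContinuousOn h {z | δ ≤ Metric.infDist z X} ∧
      ∀ z ∈ {z | δ ≤ Metric.infDist z X}, Complex.exp (h z) = (z - p) / (z - q)) ?_ ?_ ?_ hp hq
  · intro x hx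
    filter_upwards [mem_nhdsWithin_of_mem_nhds (Metric.ball_mem_nhds x hδ), self_mem_nhdsWithin]
      with y hy hyX
    have hslit : ∀ z ∈ {z | δ ≤ Metric.infDist z X}, (z - x) / (z - y) ∈ Complex.slitPlane := by
      intro z hz
      have hzy := hne y hyX z hz
      have h1 : ‖z - y‖ ≥ δ := by
        rw [← dist_eq_norm]; exact le_trans hz (Metric.infDist_le_dist_of_mem hyX)
      have h2 : (z - x) / (z - y) = 1 + (y - x) / (z - y) := by field_simp; ring
      rw [h2]
      refine Complex.mem_slitPlane_of_norm_lt_one ?_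
      rw [norm_div, div_lt_one (by linarith), ← dist_eq_norm]
      exact (Metric.mem_ball.1 hy).trans_le h1
    refine ⟨fun z => Complex.log ((z - x) / (z - y)), ?_, fun z hz => Complex.exp_log
      (Complex.slitPlane_ne_zero (hslit z hz))⟩
    refine ContinuousOn.clog ?_ hslit
    exact ContinuousOn.div (by fun_prop) (by fun_prop) (hne y hyX)
  · rintro x y w hx hy hw ⟨h, hc, he⟩ ⟨h', hc', he'⟩
    refine ⟨fun z => h z + h' z, hc.add hc', fun z hz => ?_⟩
    rw [Complex.exp_add, he z hz, he' z hz]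
    have := hne y hy z hz
    have := hne w hw z hz
    field_simp
  · rintro x y hx hy ⟨h, hc, he⟩
    refine ⟨fun z => -h z, hc.neg, fun z hz => ?_⟩
    rw [Complex.exp_neg, he z hz, inv_div]

/-- Two continua meeting in exactly two points separate the plane. -/
theorem not_isPreconnected_compl_union {X Y : Set ℂ} (hX : IsCompact X) (hY : IsCompact Y)
    (cX : IsPreconnected X) (cY : IsPreconnected Y) {p q : ℂ} (hpq : p ≠ q)
    (hXY : X ∩ Y = {p, q}) : ¬ IsPreconnected (X ∪ Y)ᶜ := by
  classical
  intro hW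
  have hp : p ∈ X ∩ Y := by rw [hXY]; simp
  have hq : q ∈ X ∩ Y := by rw [hXY]; simp
  -- Half the distance: the circle avoids `p` and `q`, and `q` lies outside it.
  set r := dist p q / 2 with hr
  have hd : 0 < dist p q := dist_pos.2 hpq
  have hr0 : 0 < r := by positivity
  have hdX : Continuous fun z => Metric.infDist z X := Metric.continuous_infDist_pt X
  have hdY : Continuous fun z => Metric.infDist z Y := Metric.continuous_infDist_pt Y
  have hsne : (Metric.sphere p r).Nonempty := NormedSpace.sphere_nonempty.2 hr0.le
  obtain ⟨z₀, hz₀, hmin⟩ := (isCompact_sphere p r).exists_isMinOn hsne (hdX.add hdY).continuousOn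
  have hpos : 0 < Metric.infDist z₀ X + Metric.infDist z₀ Y := by
    have n1 := Metric.infDist_nonneg (x := z₀) (s := X)
    have n2 := Metric.infDist_nonneg (x := z₀) (s := Y)
    rcases n1.lt_or_eq with h | h
    · linarith
    rcases n2.lt_or_eq with h' | h'
    · linarith
    exfalso
    have m1 : z₀ ∈ X := (hX.isClosed.mem_iff_infDist_zero ⟨p, hp.1⟩).2 h.symm
    have m2 : z₀ ∈ Y := (hY.isClosed.mem_iff_infDist_zero ⟨p, hp.2⟩).2 h'.symm
    have m3 : z₀ ∈ ({p, q} : Set ℂ) := hXY ▸ ⟨m1, m2⟩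
    rw [Metric.mem_sphere] at hz₀
    rcases m3 with h | h
    · rw [h, dist_self] at hz₀; linarith
    · rw [h, dist_comm] at hz₀; linarith
  -- The two distances add up to at least `2ε` on the circle, so one of them is at least `ε`.
  set ε := (Metric.infDist z₀ X + Metric.infDist z₀ Y) / 2 with hε
  have hε0 : 0 < ε := by positivity
  have hor : ∀ z ∈ Metric.sphere p r, ε ≤ Metric.infDist z X ∨ ε ≤ Metric.infDist z Y := by
    intro z hz
    have : Metric.infDist z₀ X + Metric.infDist z₀ Y ≤ Metric.infDist z X + Metric.infDist z Y :=
      hmin hz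
    by_contra! h
    linarith [h.1, h.2]
  have cl1 : IsClosed {z | ε ≤ Metric.infDist z X} := isClosed_le continuous_const hdX
  have cl2 : IsClosed {z | ε ≤ Metric.infDist z Y} := isClosed_le continuous_const hdY
  have hC₀ : IsCompact (Metric.sphere p r ∩ {z | ε ≤ Metric.infDist z X} ∩
      {z | ε ≤ Metric.infDist z Y}) := ((isCompact_sphere p r).inter_right cl1).inter_right cl2
  -- The part of the circle far from both sets may be disconnected; inside the connected complement
  -- it lies in a continuum `C`, on which the two logarithms differ by a single constant.
  obtain ⟨C, hC, cC, hC₀C, hCW⟩ := exists_isCompact_isPreconnected_between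
    (hX.isClosed.union hY.isClosed).isOpen_compl hW hC₀ (by
      rintro z ⟨⟨-, h1⟩, h2⟩ (h | h)
      · have := Metric.infDist_zero_of_mem h
        have h1 : ε ≤ Metric.infDist z X := h1
        linarith
      · have := Metric.infDist_zero_of_mem h
        have h2 : ε ≤ Metric.infDist z Y := h2
        linarith)
  obtain ⟨δ, hδ0, hδε, hδX, hδY⟩ : ∃ δ, 0 < δ ∧ δ ≤ ε ∧ (∀ z ∈ C, δ ≤ Metric.infDist z X) ∧
      ∀ z ∈ C, δ ≤ Metric.infDist z Y := by
    have aux : ∀ S : Set ℂ, IsClosed S → S.Nonempty → C ⊆ Sᶜ →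
        ∃ δ, 0 < δ ∧ ∀ z ∈ C, δ ≤ Metric.infDist z S := by
      intro S hS hSn hCS
      rcases C.eq_empty_or_nonempty with h | hne
      · exact ⟨1, one_pos, by simp [h]⟩
      obtain ⟨z, hz, hzmin⟩ := hC.exists_isMinOn hne (Metric.continuous_infDist_pt S).continuousOn
      exact ⟨_, (hS.notMem_iff_infDist_pos hSn).1 (hCS hz), fun w hw => hzmin hw⟩
    obtain ⟨δ₁, h1, h1'⟩ := aux X hX.isClosed ⟨p, hp.1⟩ (fun z hz h => hCW hz (Or.inl h))
    obtain ⟨δ₂, h2, h2'⟩ := aux Y hY.isClosed ⟨p, hp.2⟩ (fun z hz h => hCW hz (Or.inr h))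
    exact ⟨min ε (min δ₁ δ₂), lt_min hε0 (lt_min h1 h2), min_le_left _ _,
      fun z hz => ((min_le_right _ _).trans (min_le_left _ _)).trans (h1' z hz),
      fun z hz => ((min_le_right _ _).trans (min_le_right _ _)).trans (h2' z hz)⟩
  obtain ⟨h₁, ch₁, eh₁⟩ := exists_log_div_of_isPreconnected cX hp.1 hq.1 hδ0
  obtain ⟨h₂, ch₂, eh₂⟩ := exists_log_div_of_isPreconnected cY hp.2 hq.2 hδ0
  obtain ⟨c, hc1, hc⟩ := exists_const_of_exp_eq cC (ch₁.mono hδX) (ch₂.mono hδY)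
    (fun z hz => by rw [eh₁ z (hδX z hz), eh₂ z (hδY z hz)])
  let h : ℂ → ℂ := fun z => if ε ≤ Metric.infDist z X then h₁ z else h₂ z + c
  have hA : ∀ z ∈ Metric.sphere p r ∩ {z | ε ≤ Metric.infDist z X}, h z = h₁ z :=
    fun z hz => if_pos hz.2
  have hB : ∀ z ∈ Metric.sphere p r ∩ {z | ε ≤ Metric.infDist z Y}, h z = h₂ z + c := by
    intro z hz
    by_cases hzX : ε ≤ Metric.infDist z X
    · rw [hA z ⟨hz.1, hzX⟩, hc z (hC₀C ⟨⟨hz.1, hzX⟩, hz.2⟩)]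
    · exact if_neg hzX
  have hcov : Metric.sphere p r = (Metric.sphere p r ∩ {z | ε ≤ Metric.infDist z X}) ∪
      (Metric.sphere p r ∩ {z | ε ≤ Metric.infDist z Y}) := by
    rw [← inter_union_distrib_left]
    exact (inter_eq_left.2 hor).symm
  have hcont : ContinuousOn h (Metric.sphere p r) := by
    rw [hcov]
    refine ContinuousOn.union_of_isClosed ?_ ?_ (Metric.isClosed_sphere.inter cl1)
      (Metric.isClosed_sphere.inter cl2)
    · exact (ch₁.mono fun z hz => hδε.trans hz.2).congr hA
    · exact ((ch₂.mono fun z hz => hδε.trans hz.2).add continuousOn_const).congr hB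
  have hexp : ∀ z ∈ Metric.sphere p r, Complex.exp (h z) = (z - p) / (z - q) := by
    intro z hz
    rcases hor z hz with h' | h'
    · rw [hA z ⟨hz, h'⟩, eh₁ z (hδε.trans h')]
    · rw [hB z ⟨hz, h'⟩, Complex.exp_add, hc1, mul_one, eh₂ z (hδε.trans h')]
  have hzq : ∀ z ∈ Metric.sphere p r, (z - q) / (p - q) ∈ Complex.slitPlane := by
    intro z hz
    have h0 : p - q ≠ 0 := sub_ne_zero.2 hpq
    have : (z - q) / (p - q) = 1 + (z - p) / (p - q) := by field_simp; ring
    rw [this]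
    refine Complex.mem_slitPlane_of_norm_lt_one ?_
    rw [norm_div, div_lt_one (norm_pos_iff.2 h0), ← dist_eq_norm, ← dist_eq_norm,
      Metric.mem_sphere.1 hz]
    linarith
  -- Adding a logarithm of `z - q`, which exists on the circle because `q` is outside, gives a
  -- logarithm of `z - p`.
  refine not_exists_log_on_sphere (p := p) hr0
    (h := fun z => h z + (Complex.log ((z - q) / (p - q)) + Complex.log (p - q))) ?_ ?_
  · refine hcont.add (ContinuousOn.add (ContinuousOn.clog ?_ hzq) continuousOn_const)
    fun_prop
  · intro z hz
    have h0 : p - q ≠ 0 := sub_ne_zero.2 hpq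
    have h1 : z - q ≠ 0 := by
      intro h
      have := Complex.slitPlane_ne_zero (hzq z hz)
      simp [h] at this
    rw [Complex.exp_add, Complex.exp_add, hexp z hz, Complex.exp_log h0,
      Complex.exp_log (Complex.slitPlane_ne_zero (hzq z hz))]
    field_simp

/-! ### Sets linked by connected subsets -/

/-- `x` and `y` lie in a common preconnected subset of `W`. -/
def LinkedIn {X : Type*} [TopologicalSpace X] (W : Set X) (x y : X) : Prop :=
  ∃ C ⊆ W, IsPreconnected C ∧ x ∈ C ∧ y ∈ C

namespace LinkedIn

variable {X : Type*} [TopologicalSpace X] {W W' : Set X} {x y z : X}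

theorem refl (hx : x ∈ W) : LinkedIn W x x :=
  ⟨{x}, singleton_subset_iff.2 hx, isPreconnected_singleton, rfl, rfl⟩

theorem symm (h : LinkedIn W x y) : LinkedIn W y x :=
  let ⟨C, h1, h2, h3, h4⟩ := h
  ⟨C, h1, h2, h4, h3⟩

theorem trans (h : LinkedIn W x y) (h' : LinkedIn W y z) : LinkedIn W x z :=
  let ⟨C, h1, h2, h3, h4⟩ := h
  let ⟨C', h1', h2', h3', h4'⟩ := h'
  ⟨C ∪ C', union_subset h1 h1', h2.union y h4 h3' h2', Or.inl h3, Or.inr h4'⟩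

theorem mono (h : LinkedIn W x y) (hW : W ⊆ W') : LinkedIn W' x y :=
  let ⟨C, h1, h2⟩ := h
  ⟨C, h1.trans hW, h2⟩

theorem mem_left (h : LinkedIn W x y) : x ∈ W :=
  let ⟨_, h1, _, h3, _⟩ := h
  h1 h3

theorem mem_right (h : LinkedIn W x y) : y ∈ W := h.symm.mem_left

theorem iff_mem_connectedComponentIn : LinkedIn W x y ↔ y ∈ connectedComponentIn W x := by
  constructor
  · rintro ⟨C, h1, h2, h3, h4⟩
    exact h2.subset_connectedComponentIn h3 h1 h4
  · intro h
    have hx : x ∈ W := connectedComponentIn_nonempty_iff.1 ⟨y, h⟩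
    exact ⟨_, connectedComponentIn_subset W x, isPreconnected_connectedComponentIn,
      mem_connectedComponentIn hx, h⟩

end LinkedIn

theorem IsPreconnected.linkedIn {X : Type*} [TopologicalSpace X] {W C : Set X} {x y : X}
    (h : IsPreconnected C) (hCW : C ⊆ W) (hx : x ∈ C) (hy : y ∈ C) : LinkedIn W x y :=
  ⟨C, hCW, h, hx, hy⟩

theorem isPreconnected_iff_linkedIn {X : Type*} [TopologicalSpace X] {W : Set X} :
    IsPreconnected W ↔ ∀ x ∈ W, ∀ y ∈ W, LinkedIn W x y := by
  constructor
  · exact fun h x hx y hy => h.linkedIn le_rfl hx hy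
  · intro h
    refine isPreconnected_of_forall_pair fun x hx y hy => ?_
    obtain ⟨C, h1, h2, h3, h4⟩ := h x hx y hy
    exact ⟨C, h1, h3, h4, h2⟩

/-! ### Cyclic sequences -/

-- The rotation adds `1`, so its iterates reach every index. This is the tool for walking around a
-- vertex.
open scoped Fin.NatCast in
theorem finRotate_induction {d : ℕ} {Q : Fin d → Prop} (h : ∀ i, Q i → Q (finRotate d i))
    {i₀ : Fin d} (h₀ : Q i₀) (i : Fin d) : Q i := by
  obtain _ | n := d
  · exact i.elim0
  have key : ∀ k : ℕ, Q (i₀ + (k : Fin (n + 1))) := by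
    intro k
    induction k with
    | zero => simpa using h₀
    | succ k ih =>
      have := h _ ih
      rw [finRotate_apply] at this
      rw [Nat.cast_succ, ← add_assoc]
      exact this
  have := key (i - i₀).val
  rw [Fin.cast_val_eq_self, add_sub_cancel] at this
  exact this

theorem finRotate_symm_induction {d : ℕ} {Q : Fin d → Prop} (h : ∀ i, Q (finRotate d i) → Q i)
    {i₀ : Fin d} (h₀ : Q i₀) (i : Fin d) : Q i := by
  by_contra hi
  exact finRotate_induction (Q := fun i => ¬ Q i) (fun i hi hi' => hi (h i hi')) hi i₀ h₀

open scoped Classical in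
/-- In a cyclic sequence of non-zero reals, half of the sign changes go upwards. -/
theorem card_signChanges_eq {d : ℕ} {a : Fin d → ℝ} (ha : ∀ i, a i ≠ 0) :
    Fintype.card {i : Fin d // a i * a (finRotate d i) < 0} =
      2 * (Finset.univ.filter fun i : Fin d => a i < 0 ∧ 0 < a (finRotate d i)).card := by
  rw [Fintype.card_subtype]
  set U := Finset.univ.filter fun i : Fin d => a i < 0 ∧ 0 < a (finRotate d i) with hU
  set D := Finset.univ.filter fun i : Fin d => 0 < a i ∧ a (finRotate d i) < 0 with hD
  set N := Finset.univ.filter fun i : Fin d => a i < 0 ∧ a (finRotate d i) < 0 with hN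
  have h1 : (Finset.univ.filter fun i : Fin d => a i * a (finRotate d i) < 0) = U ∪ D := by
    ext i
    simp only [hU, hD, Finset.mem_filter, Finset.mem_univ, true_and, Finset.mem_union, mul_neg_iff]
    tauto
  have hUD : Disjoint U D := by
    rw [Finset.disjoint_left]
    intro i hi hi'
    simp only [hU, hD, Finset.mem_filter, Finset.mem_univ, true_and] at hi hi'
    linarith [hi.1, hi'.1]
  have hUN : Disjoint U N := by
    rw [Finset.disjoint_left]
    intro i hi hi'
    simp only [hU, hN, Finset.mem_filter, Finset.mem_univ, true_and] at hi hi'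
    linarith [hi.2, hi'.2]
  have hDN : Disjoint D N := by
    rw [Finset.disjoint_left]
    intro i hi hi'
    simp only [hD, hN, Finset.mem_filter, Finset.mem_univ, true_and] at hi hi'
    linarith [hi.1, hi'.1]
  have h2 : (Finset.univ.filter fun i : Fin d => a i < 0) = U ∪ N := by
    ext i
    simp only [hU, hN, Finset.mem_filter, Finset.mem_univ, true_and, Finset.mem_union]
    have := (ha (finRotate d i)).lt_or_gt
    tauto
  have h3 : (Finset.univ.filter fun i : Fin d => a (finRotate d i) < 0) = D ∪ N := by
    ext i
    simp only [hD, hN, Finset.mem_filter, Finset.mem_univ, true_and, Finset.mem_union]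
    have := (ha i).lt_or_gt
    tauto
  have h4 : (Finset.univ.filter fun i : Fin d => a (finRotate d i) < 0).card =
      (Finset.univ.filter fun i : Fin d => a i < 0).card := by
    refine Finset.card_bij (fun i _ => finRotate d i) ?_ ?_ ?_
    · intro i hi
      simpa using hi
    · intro i _ j _ h
      exact (finRotate d).injective h
    · intro i hi
      refine ⟨(finRotate d).symm i, ?_, Equiv.apply_symm_apply _ _⟩
      rw [Finset.mem_filter, Equiv.apply_symm_apply]
      exact ⟨Finset.mem_univ _, (Finset.mem_filter.1 hi).2⟩
  -- Counting negative terms before and after the rotation gives `#D + #N = #U + #N`.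
  rw [h2, h3, Finset.card_union_of_disjoint hUN, Finset.card_union_of_disjoint hDN] at h4
  rw [h1, Finset.card_union_of_disjoint hUD]
  omega

/-- A cyclic sequence of reals with a negative and a positive term passes from a negative to a
positive term. -/
theorem exists_neg_pos_finRotate {d : ℕ} {a : Fin d → ℝ} (ha : ∀ i, a i ≠ 0)
    (hn : ∃ i, a i < 0) (hp : ∃ i, 0 < a i) : ∃ i, a i < 0 ∧ 0 < a (finRotate d i) := by
  by_contra! h
  obtain ⟨i, hi⟩ := hn
  obtain ⟨j, hj⟩ := hp
  have := finRotate_induction (Q := fun i => a i < 0)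
    (fun i hi => lt_of_le_of_ne (h i hi) (ha _)) hi j
  linarith

/-! ### Convex polygons -/

/-- The cross product of `b - a` and `z - a`, positive if `z` is to the left of the line from `a`
to `b`. -/
def cross (a b z : ℂ) : ℝ := ((starRingEnd ℂ) (b - a) * (z - a)).im

theorem cross_eq (a b z : ℂ) :
    cross a b z = (b.re - a.re) * (z.im - a.im) - (b.im - a.im) * (z.re - a.re) := by
  simp [cross]; ring

theorem continuous_cross (a b : ℂ) : Continuous (cross a b) := by
  unfold cross; fun_prop

theorem cross_combo (a b x y : ℂ) {s t : ℝ} (h : s + t = 1) :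
    cross a b (s • x + t • y) = s * cross a b x + t * cross a b y := by
  have hs : s = 1 - t := by linarith
  subst hs
  simp only [cross_eq, Complex.add_im, Complex.add_re, Complex.real_smul, Complex.mul_re,
    Complex.mul_im, Complex.ofReal_re, Complex.ofReal_im]
  ring

theorem cross_left (a b : ℂ) : cross a b a = 0 := by rw [cross_eq]; ring

theorem cross_right (a b : ℂ) : cross a b b = 0 := by rw [cross_eq]; ring

/-- The barycentric coordinates of `z` are ratios of signed areas. -/
theorem mem_convexHull_of_cross_nonneg {a b c z : ℂ} {s : Set ℂ} (ha : a ∈ s) (hb : b ∈ s)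
    (hc : c ∈ s) (h : 0 < cross a b c) (h1 : 0 ≤ cross a b z) (h2 : 0 ≤ cross b c z)
    (h3 : 0 ≤ cross c a z) : z ∈ convexHull ℝ s := by
  have hsum : cross a b z + cross b c z + cross c a z = cross a b c := by
    simp only [cross_eq]; ring
  set D := cross a b c with hD
  have hz : z = (cross b c z / D) • a + (cross c a z / D) • b + (cross a b z / D) • c := by
    have hD0 : D ≠ 0 := h.ne'
    apply Complex.ext
    · simp only [Complex.add_re, Complex.real_smul, Complex.mul_re, Complex.ofReal_re,
        Complex.ofReal_im, zero_mul, sub_zero]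
      field_simp
      rw [hD]
      simp only [cross_eq]; ring
    · simp only [Complex.add_im, Complex.real_smul, Complex.mul_im, Complex.ofReal_re,
        Complex.ofReal_im, zero_mul, add_zero]
      field_simp
      rw [hD]
      simp only [cross_eq]; ring
  have hcv := convex_convexHull ℝ s
  have := hcv.sum_mem (t := Finset.univ) (w := ![cross b c z / D, cross c a z / D, cross a b z / D])
    (z := ![a, b, c]) (by
      intro i _
      fin_cases i
      · exact div_nonneg h2 h.le
      · exact div_nonneg h3 h.le
      · exact div_nonneg h1 h.le) (by
      simp only [Fin.sum_univ_three, Matrix.cons_val_zero, Matrix.cons_val_one, Matrix.cons_val_two,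
        Matrix.head_cons, Matrix.tail_cons]
      field_simp
      linarith) (by
      intro i _
      fin_cases i
      · exact subset_convexHull ℝ s ha
      · exact subset_convexHull ℝ s hb
      · exact subset_convexHull ℝ s hc)
  rw [hz]
  simpa [Fin.sum_univ_three] using this

theorem IsConvexPolygon.cross_pos {n : ℕ} {p : Fin n → ℂ} (hp : IsConvexPolygon p) {i j : Fin n}
    (h1 : j ≠ i) (h2 : j ≠ finRotate n i) : 0 < cross (p i) (p (finRotate n i)) (p j) :=
  hp i j h1 h2

theorem IsConvexPolygon.mem_of_cross_pos {n : ℕ} (hn : n = 3 ∨ n = 4) {p : Fin n → ℂ}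
    (hp : IsConvexPolygon p) {z : ℂ} (hz : ∀ i, 0 < cross (p i) (p (finRotate n i)) z) :
    z ∈ convexHull ℝ (range p) := by
  rcases hn with rfl | rfl
  · exact mem_convexHull_of_cross_nonneg (mem_range_self 0) (mem_range_self 1) (mem_range_self 2)
      (hp.cross_pos (i := 0) (j := 2) (by decide) (by decide)) (hz 0).le (hz 1).le (hz 2).le
  -- The diagonal from `p 0` to `p 2` cuts the quadrilateral into two triangles.
  · rcases le_total 0 (cross (p 0) (p 2) z) with h | h
    · exact mem_convexHull_of_cross_nonneg (mem_range_self 2) (mem_range_self 3) (mem_range_self 0)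
        (hp.cross_pos (i := 2) (j := 0) (by decide) (by decide)) (hz 2).le (hz 3).le h
    · exact mem_convexHull_of_cross_nonneg (mem_range_self 0) (mem_range_self 1) (mem_range_self 2)
        (hp.cross_pos (i := 0) (j := 2) (by decide) (by decide)) (hz 0).le (hz 1).le (by
          have : cross (p 2) (p 0) z = - cross (p 0) (p 2) z := by simp only [cross_eq]; ring
          linarith)

theorem IsConvexPolygon.mem_interior_of_cross_pos {n : ℕ} (hn : n = 3 ∨ n = 4) {p : Fin n → ℂ}
    (hp : IsConvexPolygon p) {z : ℂ} (hz : ∀ i, 0 < cross (p i) (p (finRotate n i)) z) :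
    z ∈ interior (convexHull ℝ (range p)) := by
  refine mem_interior.2 ⟨{z | ∀ i, 0 < cross (p i) (p (finRotate n i)) z},
    fun w hw => hp.mem_of_cross_pos hn hw, ?_, hz⟩
  simp only [ofPred_forall]
  exact isOpen_iInter_of_finite fun i => isOpen_lt continuous_const (continuous_cross _ _)

theorem exists_ne_ne_finRotate {n : ℕ} (hn : n = 3 ∨ n = 4) (i : Fin n) :
    ∃ j, j ≠ i ∧ j ≠ finRotate n i := by
  rcases hn with rfl | rfl <;> revert i <;> decide

theorem finRotate_ne {n : ℕ} (hn : n = 3 ∨ n = 4) (i : Fin n) : finRotate n i ≠ i := by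
  rcases hn with rfl | rfl <;> revert i <;> decide

theorem IsConvexPolygon.interior_nonempty {n : ℕ} (hn : n = 3 ∨ n = 4) {p : Fin n → ℂ}
    (hp : IsConvexPolygon p) : (interior (convexHull ℝ (range p))).Nonempty := by
  have hlin : ∀ a b : ℂ, cross a b ((1 / n : ℝ) • ∑ j, p j) =
      (1 / n : ℝ) * ∑ j, cross a b (p j) := by
    intro a b
    have hn0 : (n : ℝ) ≠ 0 := by rcases hn with rfl | rfl <;> norm_num
    simp only [cross_eq, Finset.sum_sub_distrib, ← Finset.mul_sum, Complex.real_smul,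
      Complex.mul_re, Complex.mul_im, Complex.ofReal_re, Complex.ofReal_im, Complex.re_sum,
      Complex.im_sum, Finset.sum_const, Finset.card_univ, Fintype.card_fin, nsmul_eq_mul]
    field_simp
    ring
  -- For the mean of the corners, each cross product is an average of nonnegative terms, at least
  -- one of them positive.
  refine ⟨(1 / n : ℝ) • ∑ j, p j, hp.mem_interior_of_cross_pos hn fun i => ?_⟩
  rw [hlin]
  have hn0 : (0 : ℝ) < n := by rcases hn with rfl | rfl <;> norm_num
  refine mul_pos (by positivity) (Finset.sum_pos' (fun j _ => ?_) ?_)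
  · by_cases h1 : j = i
    · rw [h1, cross_left]
    by_cases h2 : j = finRotate n i
    · rw [h2, cross_right]
    exact (hp.cross_pos h1 h2).le
  · obtain ⟨j, h1, h2⟩ := exists_ne_ne_finRotate hn i
    exact ⟨j, Finset.mem_univ _, hp.cross_pos h1 h2⟩

theorem IsConvexPolygon.injective {n : ℕ} (hn : n = 3 ∨ n = 4) {p : Fin n → ℂ}
    (hp : IsConvexPolygon p) : Function.Injective p := by
  intro i j hij
  by_contra hne
  by_cases h2 : j = finRotate n i
  · obtain ⟨l, h3, h4⟩ := exists_ne_ne_finRotate hn i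
    have := hp.cross_pos h3 h4
    rw [← h2, ← hij, cross_eq] at this
    simp at this
  · have := hp.cross_pos (Ne.symm hne) h2
    rw [← hij, cross_left] at this
    exact lt_irrefl _ this

/-- A point of a convex polygon is an interior point or lies on a side. -/
theorem IsConvexPolygon.mem_interior_or_mem_side {n : ℕ} (hn : n = 3 ∨ n = 4) {p : Fin n → ℂ}
    (hp : IsConvexPolygon p) {z : ℂ} (hz : z ∈ convexHull ℝ (range p)) :
    z ∈ interior (convexHull ℝ (range p)) ∨ ∃ i, ∃ t ∈ Icc (0 : ℝ) 1,
      z = AffineMap.lineMap (p i) (p (finRotate n i)) t := by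
  by_cases hpos : ∀ i, 0 < cross (p i) (p (finRotate n i)) z
  · exact Or.inl (hp.mem_interior_of_cross_pos hn hpos)
  right
  push Not at hpos
  obtain ⟨i, hi⟩ := hpos
  refine ⟨i, ?_⟩
  set a := p i
  set b := p (finRotate n i)
  -- The right-hand side is convex and contains the corners; strict convexity excludes other corners
  -- on the line through the side.
  have hsub : convexHull ℝ (range p) ⊆ {w | 0 ≤ cross a b w ∧ (cross a b w = 0 →
      w ∈ segment ℝ a b)} := by
    refine convexHull_min ?_ ?_
    · rintro _ ⟨j, rfl⟩
      by_cases h1 : j = i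
      · rw [h1]
        exact ⟨(cross_left _ _).ge, fun _ => left_mem_segment ℝ _ _⟩
      by_cases h2 : j = finRotate n i
      · rw [h2]
        exact ⟨(cross_right _ _).ge, fun _ => right_mem_segment ℝ _ _⟩
      have := hp.cross_pos h1 h2
      exact ⟨this.le, fun h => absurd h this.ne'⟩
    · rintro x ⟨hx, hx'⟩ y ⟨hy, hy'⟩ s t hs ht hst
      simp only [mem_ofPred_eq, cross_combo a b x y hst]
      refine ⟨by positivity, fun h => ?_⟩
      rcases hs.eq_or_lt with rfl | hs
      · have : t = 1 := by linarith
        subst this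
        simp only [zero_mul, one_mul, zero_add] at h
        simpa using hy' h
      rcases ht.eq_or_lt with rfl | ht
      · have : s = 1 := by linarith
        subst this
        simp only [zero_mul, one_mul, add_zero] at h
        simpa using hx' h
      have h1 : 0 ≤ s * cross a b x := by positivity
      have h2 : 0 ≤ t * cross a b y := by positivity
      have h3 : cross a b x = 0 := by
        rcases mul_eq_zero.1 (show s * cross a b x = 0 by linarith) with h | h
        · exact absurd h hs.ne'
        · exact h
      have h4 : cross a b y = 0 := by
        rcases mul_eq_zero.1 (show t * cross a b y = 0 by linarith) with h | h
        · exact absurd h ht.ne'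
        · exact h
      exact (convex_segment a b) (hx' h3) (hy' h4) hs.le ht.le hst
  have h1 := hsub hz
  have h2 := h1.2 (le_antisymm hi h1.1)
  rw [segment_eq_image_lineMap] at h2
  obtain ⟨t, ht, rfl⟩ := h2
  exact ⟨t, ht, rfl⟩

theorem le_of_le_corner {n : ℕ} {p : Fin n → ℂ} (A : ℂ →ᵃ[ℝ] ℝ) {m : ℝ} (h : ∀ j, m ≤ A (p j))
    {z : ℂ} (hz : z ∈ convexHull ℝ (range p)) : m ≤ A z := by
  have hc : Convex ℝ (A ⁻¹' Ici m) := (convex_Ici m).affine_preimage A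
  exact convexHull_min (by rintro _ ⟨j, rfl⟩; exact h j) hc hz

theorem AffineMap.apply_of_combo (A : ℂ →ᵃ[ℝ] ℝ) {o x y z : ℂ} {α β : ℝ}
    (h : z - o = α • (x - o) + β • (y - o)) :
    A z - A o = α * (A x - A o) + β * (A y - A o) := by
  have e : ∀ w, A w - A o = A.linear (w - o) := fun w => by
    have := A.linearMap_vsub w o
    simpa using this.symm
  rw [e, e, e, h, map_add, map_smul, map_smul, smul_eq_mul, smul_eq_mul]

/-- If an affine function increases along both sides of a convex polygon at a corner, its minimum
on the polygon is at this corner. -/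
theorem IsConvexPolygon.corner_le {n : ℕ} (hn : n = 3 ∨ n = 4) {p : Fin n → ℂ}
    (hp : IsConvexPolygon p) (A : ℂ →ᵃ[ℝ] ℝ) (j : Fin n) (h1 : A (p j) ≤ A (p (finRotate n j)))
    (h2 : A (p j) ≤ A (p ((finRotate n).symm j))) {z : ℂ} (hz : z ∈ convexHull ℝ (range p)) :
    A (p j) ≤ A z := by
  refine le_of_le_corner A (fun l => ?_) hz
  by_cases e0 : l = j
  · rw [e0]
  by_cases e1 : l = finRotate n j
  · rwa [e1]
  by_cases e2 : l = (finRotate n).symm j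
  · rwa [e2]
  have h3 := hp.cross_pos e0 e1
  have h4 := hp.cross_pos (i := (finRotate n).symm j) (j := l) e2 (by rwa [Equiv.apply_symm_apply])
  have hne : (finRotate n).symm j ≠ j := fun h => finRotate_ne hn j (by
    rw [Equiv.symm_apply_eq] at h; exact h.symm)
  have hne' : finRotate n j ≠ (finRotate n).symm j := by
    clear h1 h2 e0 e1 e2 h3 h4 hne
    rcases hn with rfl | rfl <;> revert j <;> decide
  have h5 := hp.cross_pos (i := (finRotate n).symm j) (j := finRotate n j) hne'
    (by rw [Equiv.apply_symm_apply]; exact finRotate_ne hn j)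
  simp only [Equiv.apply_symm_apply] at h4 h5
  set o := p j
  set x := p (finRotate n j)
  set y := p ((finRotate n).symm j)
  set w := p l
  have h6 : cross o x y = cross y o x := by simp only [cross_eq]; ring
  -- Any further corner lies in the cone spanned by the two sides at `o`; Cramer's rule gives the
  -- coefficients.
  have hcomb : w - o = (cross y o w / cross y o x) • (x - o) +
      (cross o x w / cross y o x) • (y - o) := by
    have hD0 := h5.ne'
    apply Complex.ext
    · simp only [Complex.add_re, Complex.real_smul, Complex.mul_re, Complex.ofReal_re,
        Complex.ofReal_im, zero_mul, sub_zero, Complex.sub_re]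
      field_simp
      simp only [cross_eq]; ring
    · simp only [Complex.add_im, Complex.real_smul, Complex.mul_im, Complex.ofReal_re,
        Complex.ofReal_im, zero_mul, add_zero, Complex.sub_im]
      field_simp
      simp only [cross_eq]; ring
  have h7 := A.apply_of_combo hcomb
  have : 0 ≤ cross y o w / cross y o x * (A x - A o) + cross o x w / cross y o x * (A y - A o) :=
    add_nonneg (mul_nonneg (div_nonneg h4.le h5.le) (by linarith))
      (mul_nonneg (div_nonneg h3.le h5.le) (by linarith))
  linarith

/-! ### Cell decompositions -/

namespace CellDecomposition

variable {Ω : Set ℂ} (T : CellDecomposition Ω)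

/-- The model polygon of a `2`-cell. -/
def poly (f : T.F) : Set ℂ := convexHull ℝ (range (T.corner f))

theorem convex_poly (f : T.F) : Convex ℝ (T.poly f) := convex_convexHull ℝ _

theorem isCompact_poly (f : T.F) : IsCompact (T.poly f) :=
  (finite_range _).isCompact_convexHull ℝ

theorem corner_mem (f : T.F) (i : Fin (T.sides f)) : T.corner f i ∈ T.poly f :=
  subset_convexHull ℝ _ (mem_range_self i)

theorem chart_corner (f : T.F) (i : Fin (T.sides f)) :
    T.chart f (T.corner f i) = T.vtx f i := by
  have := T.chart_side f i 0 ⟨le_rfl, zero_le_one⟩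
  rwa [AffineMap.lineMap_apply_zero, T.arc_zero _ _ (T.side_adj f i)] at this

theorem side_mem (f : T.F) (i : Fin (T.sides f)) {t : ℝ} (ht : t ∈ Icc (0 : ℝ) 1) :
    AffineMap.lineMap (T.corner f i) (T.corner f (finRotate _ i)) t ∈ T.poly f :=
  (T.convex_poly f).lineMap_mem (T.corner_mem f _) (T.corner_mem f _) ht

/-- A point of a model polygon is an interior point, an inner point of a side, or a corner. -/
theorem mem_poly_cases {f : T.F} {ζ : ℂ} (hζ : ζ ∈ T.poly f) :
    ζ ∈ interior (T.poly f) ∨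
    (∃ i, ∃ t ∈ Ioo (0 : ℝ) 1, ζ = AffineMap.lineMap (T.corner f i) (T.corner f (finRotate _ i)) t ∧
      T.chart f ζ = T.arc (T.vtx f i) (T.vtx f (finRotate _ i)) t) ∨
    ∃ i, ζ = T.corner f i := by
  rcases (T.corner_convex f).mem_interior_or_mem_side (T.sides_eq f) hζ with h | ⟨i, t, ht, rfl⟩
  · exact Or.inl h
  right
  rcases ht.1.eq_or_lt with rfl | h0
  · exact Or.inr ⟨i, by simp⟩
  rcases ht.2.eq_or_lt with rfl | h1
  · exact Or.inr ⟨finRotate _ i, by simp⟩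
  exact Or.inl ⟨i, t, ⟨h0, h1⟩, rfl, T.chart_side f i t ht⟩

/-- Disjointness of the open cells excludes the other positions. This lemma and the next two recover
incidences from coincidences of points. -/
theorem eq_corner_of_chart_eq_vertex {f : T.F} {ζ : ℂ} (hζ : ζ ∈ T.poly f) {w : T.V}
    (h : T.chart f ζ = w) : ∃ i, ζ = T.corner f i ∧ T.vtx f i = w := by
  rcases T.mem_poly_cases hζ with h' | ⟨i, t, ht, -, h'⟩ | ⟨i, rfl⟩
  · exact absurd ⟨ζ, h', h⟩ (T.vertex_notMem_face w f)
  · exact absurd ⟨t, ht, h'.symm.trans h⟩ (T.vertex_notMem_edge w _ _ (T.side_adj f i))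
  · refine ⟨i, rfl, Subtype.ext ?_⟩
    rw [← h, T.chart_corner]

theorem side_of_chart_eq_arc {f : T.F} {ζ : ℂ} (hζ : ζ ∈ T.poly f) {u v : T.V}
    (huv : T.graph.Adj u v) {t : ℝ} (ht : t ∈ Ioo (0 : ℝ) 1) (h : T.chart f ζ = T.arc u v t) :
    ∃ i, s(u, v) = s(T.vtx f i, T.vtx f (finRotate _ i)) := by
  rcases T.mem_poly_cases hζ with h' | ⟨i, t', ht', -, h'⟩ | ⟨i, rfl⟩
  · exact absurd ⟨ζ, h', h⟩ (Set.disjoint_left.1 (T.edge_disjoint_face u v f huv) ⟨t, ht, rfl⟩)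
  · refine ⟨i, ?_⟩
    by_contra hne
    exact Set.disjoint_left.1 (T.edge_disjoint_edge _ _ _ _ huv (T.side_adj f i) hne)
      ⟨t, ht, rfl⟩ ⟨t', ht', h'.symm.trans h⟩
  · rw [T.chart_corner] at h
    exact absurd ⟨t, ht, h.symm⟩ (T.vertex_notMem_edge _ _ _ huv)

theorem face_eq_of_mem_interior {f f' : T.F} {ζ ζ' : ℂ} (hζ : ζ ∈ interior (T.poly f))
    (hζ' : ζ' ∈ T.poly f') (h : T.chart f ζ = T.chart f' ζ') : f' = f := by
  by_contra hne
  rcases T.mem_poly_cases hζ' with h' | ⟨i, t', ht', -, h'⟩ | ⟨i, rfl⟩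
  · exact Set.disjoint_left.1 (T.face_disjoint_face f f' (Ne.symm hne)) ⟨ζ, hζ, rfl⟩ ⟨ζ', h', h.symm⟩
  · exact Set.disjoint_left.1 (T.edge_disjoint_face _ _ f (T.side_adj f' i)) ⟨t', ht', rfl⟩
      ⟨ζ, hζ, h.trans h'⟩
  · rw [T.chart_corner] at h
    exact T.vertex_notMem_face _ f ⟨ζ, hζ, h⟩

theorem arc_subset_closure {u v : T.V} (huv : T.graph.Adj u v) {t : ℝ} (ht : t ∈ Icc (0 : ℝ) 1) :
    T.arc u v t ∈ closure Ω := by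
  rcases ht.1.eq_or_lt with rfl | h0
  · rw [T.arc_zero u v huv]; exact T.vertex_mem u
  rcases ht.2.eq_or_lt with rfl | h1
  · rw [T.arc_one u v huv]; exact T.vertex_mem v
  rcases T.edge_subset u v huv with h | h
  · exact subset_closure (h ⟨t, ⟨h0, h1⟩, rfl⟩)
  · exact frontier_subset_closure (h ⟨t, ⟨h0, h1⟩, rfl⟩)

theorem chart_mem_closure {f : T.F} {ζ : ℂ} (hζ : ζ ∈ T.poly f) : T.chart f ζ ∈ closure Ω := by
  rcases T.mem_poly_cases hζ with h' | ⟨i, t, ht, -, h'⟩ | ⟨i, rfl⟩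
  · exact subset_closure (T.face_subset f ⟨ζ, h', rfl⟩)
  · rw [h']; exact T.arc_subset_closure (T.side_adj f i) ⟨ht.1.le, ht.2.le⟩
  · rw [T.chart_corner]; exact T.vertex_mem _

theorem exists_face {z : ℂ} (hz : z ∈ closure Ω) : ∃ f, ∃ ζ ∈ T.poly f, T.chart f ζ = z := by
  obtain ⟨f, ζ, h1, h2⟩ := mem_iUnion.1 (T.covers hz)
  exact ⟨f, ζ, h1, h2⟩

/-- The midpoint of the edge lies in some closed `2`-cell, and there it can only lie on a side. -/
theorem exists_side {u v : T.V} (huv : T.graph.Adj u v) :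
    ∃ f i, s(u, v) = s(T.vtx f i, T.vtx f (finRotate _ i)) := by
  obtain ⟨f, ζ, h1, h2⟩ := T.exists_face
    (T.arc_subset_closure huv (t := 1 / 2) ⟨by norm_num, by norm_num⟩)
  exact ⟨f, T.side_of_chart_eq_arc h1 huv ⟨by norm_num, by norm_num⟩ h2⟩

theorem isCompact_image_poly (f : T.F) : IsCompact (T.chart f '' T.poly f) :=
  (T.isCompact_poly f).image_of_continuousOn (T.chart_continuousOn f)

/-- Close to `p` there are only the `2`-cells which contain `p`. -/
theorem eventually_mem_face (p : ℂ) :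
    ∀ᶠ y in 𝓝 p, ∀ f, y ∈ T.chart f '' T.poly f → p ∈ T.chart f '' T.poly f := by
  have := T.finite_F
  rw [eventually_all]
  intro f
  by_cases hp : p ∈ T.chart f '' T.poly f
  · exact Eventually.of_forall fun _ _ => hp
  · filter_upwards [(T.isCompact_image_poly f).isClosed.isOpen_compl.mem_nhds hp] with y hy hy'
    exact absurd hy' hy

variable {T} in
theorem adj_cases {u v u' v' : T.V} (h : s(u, v) = s(u', v')) :
    (u = u' ∧ v = v') ∨ (u = v' ∧ v = u') := by
  simpa using h

/-! ### The affine extension -/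

section Extension

variable {T} {g : T.V → ℝ} {gbar : ℂ → ℝ} (hgbar : T.IsAffineExtension g gbar)
include hgbar

theorem IsAffineExtension.neg : T.IsAffineExtension (-g) (-gbar) where
  vertex v := by simp [hgbar.vertex v]
  affine f := by
    obtain ⟨A, hA⟩ := hgbar.affine f
    exact ⟨-A, fun z hz => by simp [hA z hz]⟩

theorem IsAffineExtension.exists_affine (f : T.F) : ∃ A : ℂ →ᵃ[ℝ] ℝ,
    (∀ ζ ∈ T.poly f, gbar (T.chart f ζ) = A ζ) ∧ ∀ i, A (T.corner f i) = g (T.vtx f i) := by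
  obtain ⟨A, hA⟩ := hgbar.affine f
  refine ⟨A, hA, fun i => ?_⟩
  rw [← hA _ (T.corner_mem f i), T.chart_corner, hgbar.vertex]

theorem IsAffineExtension.apply_arc {u v : T.V} (huv : T.graph.Adj u v) {t : ℝ}
    (ht : t ∈ Icc (0 : ℝ) 1) : gbar (T.arc u v t) = (1 - t) * g u + t * g v := by
  obtain ⟨f, i, h⟩ := T.exists_side huv
  obtain ⟨A, hA, hAi⟩ := hgbar.exists_affine f
  have key : ∀ t ∈ Icc (0 : ℝ) 1, gbar (T.arc (T.vtx f i) (T.vtx f (finRotate _ i)) t) =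
      (1 - t) * g (T.vtx f i) + t * g (T.vtx f (finRotate _ i)) := by
    intro t ht
    rw [← T.chart_side f i t ht, hA _ (T.side_mem f i ht), AffineMap.apply_lineMap, hAi, hAi,
      AffineMap.lineMap_apply_module, smul_eq_mul, smul_eq_mul]
  rcases adj_cases h with ⟨rfl, rfl⟩ | ⟨rfl, rfl⟩
  · exact key t ht
  · rw [T.arc_symm _ _ huv.symm t ht, key _ ⟨by linarith [ht.2], by linarith [ht.1]⟩]; ring

/-- Finitely many compact cells cover the closure, so the preimage of a closed set is a finite union
of compact images. -/
theorem IsAffineExtension.continuousOn : ContinuousOn gbar (closure Ω) := by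
  have := T.finite_F
  rw [continuousOn_iff_isClosed]
  intro C hC
  refine ⟨⋃ f, T.chart f '' (T.poly f ∩ {ζ | gbar (T.chart f ζ) ∈ C}), ?_, ?_⟩
  · refine isClosed_iUnion_of_finite fun f => ?_
    obtain ⟨A, hA, -⟩ := hgbar.exists_affine f
    have : T.poly f ∩ {ζ | gbar (T.chart f ζ) ∈ C} = T.poly f ∩ A ⁻¹' C := by
      ext ζ
      refine and_congr_right fun hζ => ?_
      rw [mem_ofPred_eq, hA ζ hζ]; rfl
    rw [this]
    exact (((T.isCompact_poly f).inter_right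
      (hC.preimage A.continuous_of_finiteDimensional)).image_of_continuousOn
      ((T.chart_continuousOn f).mono inter_subset_left)).isClosed
  · ext z
    constructor
    · rintro ⟨h1, h2⟩
      obtain ⟨f, ζ, hζ, rfl⟩ := T.exists_face h2
      exact ⟨mem_iUnion.2 ⟨f, ζ, ⟨hζ, h1⟩, rfl⟩, h2⟩
    · rintro ⟨h1, h2⟩
      obtain ⟨f, ζ, ⟨hζ, h3⟩, rfl⟩ := mem_iUnion.1 h1
      exact ⟨h3, h2⟩

/-- A half-plane cuts the model polygon in a convex set, whose image under the chart is connected.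
-/
theorem IsAffineExtension.linkedIn_face_gt {f : T.F} {t : ℝ} {ζ ζ' : ℂ} (hζ : ζ ∈ T.poly f)
    (hζ' : ζ' ∈ T.poly f) (h : t < gbar (T.chart f ζ)) (h' : t < gbar (T.chart f ζ')) :
    LinkedIn {w ∈ closure Ω | t < gbar w} (T.chart f ζ) (T.chart f ζ') := by
  obtain ⟨A, hA, -⟩ := hgbar.exists_affine f
  have hc : Convex ℝ (T.poly f ∩ A ⁻¹' Ioi t) :=
    (T.convex_poly f).inter ((convex_Ioi t).affine_preimage A)
  refine (hc.isPreconnected.image (T.chart f)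
    ((T.chart_continuousOn f).mono inter_subset_left)).linkedIn ?_ ⟨ζ, ⟨hζ, ?_⟩, rfl⟩
    ⟨ζ', ⟨hζ', ?_⟩, rfl⟩
  · rintro _ ⟨ξ, ⟨hξ, h1⟩, rfl⟩
    exact ⟨T.chart_mem_closure hξ, by rw [hA ξ hξ]; exact h1⟩
  · rw [hA ζ hζ] at h; exact h
  · rw [hA ζ' hζ'] at h'; exact h'

theorem IsAffineExtension.linkedIn_face_lt {f : T.F} {t : ℝ} {ζ ζ' : ℂ} (hζ : ζ ∈ T.poly f)
    (hζ' : ζ' ∈ T.poly f) (h : gbar (T.chart f ζ) < t) (h' : gbar (T.chart f ζ') < t) :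
    LinkedIn {w ∈ closure Ω | gbar w < t} (T.chart f ζ) (T.chart f ζ') := by
  have := hgbar.neg.linkedIn_face_gt (t := -t) hζ hζ' (neg_lt_neg h) (neg_lt_neg h')
  simpa using this

theorem IsAffineExtension.linkedIn_edge_gt {u v : T.V} (huv : T.graph.Adj u v) {t : ℝ}
    (hu : t < g u) (hv : t < g v) : LinkedIn {w ∈ closure Ω | t < gbar w} u v := by
  obtain ⟨f, i, h⟩ := T.exists_side huv
  have key : t < g (T.vtx f i) → t < g (T.vtx f (finRotate _ i)) →
      LinkedIn {w ∈ closure Ω | t < gbar w} (T.vtx f i : ℂ) (T.vtx f (finRotate _ i)) := by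
    intro h1 h2
    rw [← T.chart_corner, ← T.chart_corner]
    refine hgbar.linkedIn_face_gt (T.corner_mem f _) (T.corner_mem f _) ?_ ?_
    · rwa [T.chart_corner, hgbar.vertex]
    · rwa [T.chart_corner, hgbar.vertex]
  rcases adj_cases h with ⟨rfl, rfl⟩ | ⟨rfl, rfl⟩
  · exact key hu hv
  · exact (key hv hu).symm

end Extension

/-! ### The maximum principle. -/

/-- Every vertex in `Ω` has a neighbor with a larger value. -/
def HasHigherNeighbors (g : T.V → ℝ) : Prop :=
  ∀ v : T.V, (v : ℂ) ∈ Ω → ∃ w, T.graph.Adj v w ∧ g v < g w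

/-- An open edge inside the closed set `∂Ω` would have its endpoints there too. -/
theorem arc_subset_of_mem (hΩ : IsOpen Ω) {u v : T.V} (huv : T.graph.Adj u v) (hu : (u : ℂ) ∈ Ω) :
    T.arc u v '' Ioo 0 1 ⊆ Ω := by
  rcases T.edge_subset u v huv with h | h
  · exact h
  exfalso
  have h1 : (u : ℂ) ∈ frontier Ω := by
    have hc : (0 : ℝ) ∈ closure (Ioo (0 : ℝ) 1) := by
      rw [closure_Ioo zero_ne_one]; exact ⟨le_rfl, zero_le_one⟩
    have := ((T.arc_continuousOn u v huv 0 ⟨le_rfl, zero_le_one⟩).mono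
      Ioo_subset_Icc_self).mem_closure_image hc
    rw [T.arc_zero u v huv] at this
    exact closure_minimal h isClosed_frontier this
  rw [hΩ.frontier_eq] at h1
  exact h1.2 hu

theorem exists_adj (v : T.V) : ∃ w, T.graph.Adj v w := by
  obtain ⟨f, ζ, hζ, h⟩ := T.exists_face (T.vertex_mem v)
  obtain ⟨i, -, rfl⟩ := T.eq_corner_of_chart_eq_vertex hζ h
  exact ⟨_, T.side_adj f i⟩

theorem SeparatesAdjacent.neg {T : CellDecomposition Ω} {g : T.V → ℝ} (h : T.SeparatesAdjacent g) :
    T.SeparatesAdjacent (-g) := fun u v huv h' he => h u v huv h' (neg_injective he)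

theorem laplacian_neg (c : T.V → T.V → ℝ) (g : T.V → ℝ) (x : T.V) :
    T.laplacian c (-g) x = - T.laplacian c g x := by
  simp only [laplacian, ← Finset.sum_neg_distrib, Pi.neg_apply]
  exact Finset.sum_congr rfl fun _ _ => by ring

/-- With no higher neighbor, all neighbors would be strictly lower and every term of the Laplacian
positive. Applied to `-g` it yields lower neighbors. -/
theorem hasHigherNeighbors_of_harmonic {T : CellDecomposition Ω} (hΩ : IsOpen Ω)
    {c : T.V → T.V → ℝ} (hc : T.IsConductance c) {g : T.V → ℝ} (hsep : T.SeparatesAdjacent g)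
    (hg : ∀ x : T.V, (x : ℂ) ∈ Ω → T.laplacian c g x = 0) : T.HasHigherNeighbors g := by
  classical
  intro v hv
  by_contra! h
  have h1 : 0 < T.laplacian c g v := by
    unfold laplacian
    refine Finset.sum_pos (fun w hw => ?_) ?_
    · have hvw := (Finset.mem_filter.1 hw).2
      have := hsep v w hvw (T.arc_subset_of_mem hΩ hvw hv)
      exact mul_pos (hc v w hvw).1 (sub_pos.2 (lt_of_le_of_ne (h w hvw) (Ne.symm this)))
    · obtain ⟨w, hw⟩ := T.exists_adj v
      exact ⟨w, Finset.mem_filter.2 ⟨Finset.mem_univ _, hw⟩⟩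
  rw [hg v hv] at h1
  exact lt_irrefl _ h1

section Extension

variable {T} {g : T.V → ℝ} {gbar : ℂ → ℝ} (hgbar : T.IsAffineExtension g gbar)
include hgbar

theorem IsAffineExtension.exists_corner_gt {f : T.F} {t : ℝ} {ζ : ℂ} (hζ : ζ ∈ T.poly f)
    (h : t < gbar (T.chart f ζ)) : ∃ i, t < g (T.vtx f i) := by
  obtain ⟨A, hA, hAi⟩ := hgbar.exists_affine f
  by_contra! hcon
  have := le_of_le_corner (p := T.corner f) (-A) (m := -t)
    (fun j => by simpa [hAi] using hcon j) hζ
  rw [hA ζ hζ] at h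
  simp at this
  linarith

/-- The maximum principle: a point above the level `t` is linked, above this level, to a boundary
vertex. -/
theorem IsAffineExtension.exists_linkedIn_vertex (hh : T.HasHigherNeighbors g) {t : ℝ} {z : ℂ}
    (hz : z ∈ closure Ω) (hzt : t < gbar z) :
    ∃ u : T.V, (u : ℂ) ∉ Ω ∧ LinkedIn {w ∈ closure Ω | t < gbar w} z u := by
  classical
  obtain ⟨f, ζ, hζ, rfl⟩ := T.exists_face hz
  obtain ⟨i, hi⟩ := hgbar.exists_corner_gt hζ hzt
  have h0 : LinkedIn {w ∈ closure Ω | t < gbar w} (T.chart f ζ) (T.vtx f i) := by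
    rw [← T.chart_corner f i]
    exact hgbar.linkedIn_face_gt hζ (T.corner_mem f i) hzt
      (by rwa [T.chart_corner, hgbar.vertex])
  -- A highest vertex linked to the point cannot lie in `Ω`, since the edge to a higher neighbor
  -- would extend the link.
  obtain ⟨u, hu, hmax⟩ := Finset.exists_max_image
    (Finset.univ.filter fun u : T.V => LinkedIn {w ∈ closure Ω | t < gbar w} (T.chart f ζ) u) g
    ⟨_, Finset.mem_filter.2 ⟨Finset.mem_univ _, h0⟩⟩
  have hu' := (Finset.mem_filter.1 hu).2
  refine ⟨u, fun huΩ => ?_, hu'⟩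
  obtain ⟨w, hw, hlt⟩ := hh u huΩ
  have hut : t < g u := by have := hu'.mem_right.2; rwa [hgbar.vertex] at this
  have := hmax w (Finset.mem_filter.2 ⟨Finset.mem_univ _,
    hu'.trans (hgbar.linkedIn_edge_gt hw hut (hut.trans hlt))⟩)
  linarith

/-- A point of a `2`-cell is adherent to the part of this cell towards any corner with a larger
value. -/
theorem IsAffineExtension.mem_closure_of_corner_gt {f : T.F} {ζ : ℂ} (hζ : ζ ∈ T.poly f)
    {i : Fin (T.sides f)} (hi : gbar (T.chart f ζ) < g (T.vtx f i)) :
    T.chart f ζ ∈ closure {w ∈ closure Ω | gbar (T.chart f ζ) < gbar w} := by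
  obtain ⟨A, hA, hAi⟩ := hgbar.exists_affine f
  have hsub : openSegment ℝ ζ (T.corner f i) ⊆ T.poly f :=
    (T.convex_poly f).openSegment_subset hζ (T.corner_mem f i)
  have h1 : ζ ∈ closure (openSegment ℝ ζ (T.corner f i)) := by
    rw [closure_openSegment]; exact left_mem_segment ℝ _ _
  have h2 := ((T.chart_continuousOn f ζ hζ).mono hsub).mem_closure_image h1
  refine closure_mono ?_ h2
  rintro _ ⟨ξ, hξ, rfl⟩
  refine ⟨T.chart_mem_closure (hsub hξ), ?_⟩
  rw [hA ξ (hsub hξ), hA ζ hζ]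
  rw [hA ζ hζ, ← hAi] at hi
  rw [openSegment_eq_image_lineMap] at hξ
  obtain ⟨s, hs, rfl⟩ := hξ
  rw [AffineMap.apply_lineMap, AffineMap.lineMap_apply_module, smul_eq_mul, smul_eq_mul]
  nlinarith [hs.1]

/-- No point of `Ω` is a local maximum. -/
theorem IsAffineExtension.mem_closure_gt (hΩ : IsOpen Ω) (hh : T.HasHigherNeighbors g)
    (hsep : T.SeparatesAdjacent g) (hnc : ∀ f, ∃ i j, g (T.vtx f i) ≠ g (T.vtx f j)) {z : ℂ}
    (hz : z ∈ Ω) : z ∈ closure {w ∈ closure Ω | gbar z < gbar w} := by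
  obtain ⟨f, ζ, hζ, rfl⟩ := T.exists_face (subset_closure hz)
  rcases T.mem_poly_cases hζ with h | ⟨i, t, ht, -, h⟩ | ⟨i, rfl⟩
  · obtain ⟨A, hA, hAi⟩ := hgbar.exists_affine f
    by_cases hex : ∃ i, gbar (T.chart f ζ) < g (T.vtx f i)
    · obtain ⟨i, hi⟩ := hex
      exact hgbar.mem_closure_of_corner_gt hζ hi
    exfalso
    push Not at hex
    obtain ⟨i, hi⟩ : ∃ i, g (T.vtx f i) < gbar (T.chart f ζ) := by
      by_contra! hcon
      obtain ⟨i, j, hij⟩ := hnc f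
      exact hij ((le_antisymm (hex i) (hcon i)).trans (le_antisymm (hex j) (hcon j)).symm)
    have hmap : Tendsto (fun s : ℝ => AffineMap.lineMap ζ (T.corner f i) s) (𝓝 0) (𝓝 ζ) := by
      have : Continuous fun s : ℝ => (AffineMap.lineMap ζ (T.corner f i) s : ℂ) :=
        AffineMap.lineMap_continuous
      simpa using this.tendsto 0
    have hev := hmap (isOpen_interior.mem_nhds h)
    obtain ⟨ε, hε, hball⟩ := Metric.mem_nhds_iff.1 hev
    -- Stepping away from a lower corner increases the affine function, beyond its supposed maximum
    -- on the cell.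
    have hξ : (AffineMap.lineMap ζ (T.corner f i) (-(ε / 2)) : ℂ) ∈ T.poly f :=
      interior_subset (hball (by simp [abs_of_pos hε, hε]))
    have h3 := le_of_le_corner (p := T.corner f) (-A) (m := -gbar (T.chart f ζ))
      (fun j => by simpa [hAi] using hex j) hξ
    simp only [AffineMap.coe_neg, Pi.neg_apply, neg_le_neg_iff] at h3
    rw [AffineMap.apply_lineMap, AffineMap.lineMap_apply_module, smul_eq_mul, smul_eq_mul, hA ζ hζ,
      hAi] at h3
    rw [hA ζ hζ] at hi
    nlinarith
  · have hne := hsep _ _ (T.side_adj f i) (by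
      rcases T.edge_subset _ _ (T.side_adj f i) with h' | h'
      · exact h'
      · have := h' ⟨t, ht, h.symm⟩
        rw [hΩ.frontier_eq] at this
        exact absurd hz this.2)
    have hv : gbar (T.chart f ζ) = _ := (congrArg gbar h).trans
      (hgbar.apply_arc (T.side_adj f i) ⟨ht.1.le, ht.2.le⟩)
    rcases hne.lt_or_gt with h' | h'
    · exact hgbar.mem_closure_of_corner_gt hζ (i := finRotate _ i) (by
        rw [hv]; nlinarith [ht.1, ht.2])
    · exact hgbar.mem_closure_of_corner_gt hζ (i := i) (by rw [hv]; nlinarith [ht.1, ht.2])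
  · rw [T.chart_corner] at hz ⊢
    obtain ⟨w, hw, hlt⟩ := hh _ hz
    obtain ⟨f', j, hs⟩ := T.exists_side hw
    obtain ⟨a, b, ha, hb⟩ : ∃ a b, T.vtx f i = T.vtx f' a ∧ w = T.vtx f' b := by
      rcases adj_cases hs with ⟨h1, h2⟩ | ⟨h1, h2⟩
      · exact ⟨_, _, h1, h2⟩
      · exact ⟨_, _, h1, h2⟩
    rw [ha, ← T.chart_corner]
    refine hgbar.mem_closure_of_corner_gt (T.corner_mem f' a) (i := b) ?_
    rw [T.chart_corner, hgbar.vertex, ← ha, ← hb]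
    exact hlt

end Extension

end CellDecomposition

namespace CellDecomposition

variable {Ω : Set ℂ} {T : CellDecomposition Ω}

/-! ### Boundary values -/

section Boundary

variable {g : T.V → ℝ} {gbar : ℂ → ℝ}

/-- A boundary point inside an edge puts the whole closed edge in one component of the complement,
so both endpoints have value `m`. The form serves the inner and the outer boundary alike. -/
theorem IsAffineExtension.eq_of_mem_frontier (hgbar : T.IsAffineExtension g gbar) (hΩ : IsOpen Ω)
    {z : ℂ} (hz : z ∈ frontier Ω) {m : ℝ}
    (h : ∀ u : T.V, (u : ℂ) ∈ frontier Ω →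
      connectedComponentIn Ωᶜ u = connectedComponentIn Ωᶜ z → g u = m) : gbar z = m := by
  have hfc : frontier Ω ⊆ Ωᶜ := by rw [hΩ.frontier_eq]; exact fun x hx => hx.2
  obtain ⟨f, ζ, hζ, rfl⟩ := T.exists_face (frontier_subset_closure hz)
  rcases T.mem_poly_cases hζ with h' | ⟨i, t, ht, -, h'⟩ | ⟨i, rfl⟩
  · exact absurd (T.face_subset f ⟨ζ, h', rfl⟩) (hfc hz)
  · rw [h'] at hz h ⊢
    have hadj := T.side_adj f i
    have hmem : ∀ u : T.V, (u : ℂ) ∈ T.arc (T.vtx f i) (T.vtx f (finRotate _ i)) '' Icc 0 1 →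
        (u : ℂ) ∉ Ω → g u = m := by
      intro u hu huΩ
      refine h u (by rw [hΩ.frontier_eq]; exact ⟨T.vertex_mem u, huΩ⟩) (connectedComponentIn_eq ?_)
      refine (isPreconnected_Icc.image _ (T.arc_continuousOn _ _ hadj)).subset_connectedComponentIn
        hu ?_ ⟨t, ⟨ht.1.le, ht.2.le⟩, rfl⟩
      rcases T.edge_subset _ _ hadj with h1 | h1
      · exact absurd (h1 ⟨t, ht, rfl⟩) (hfc hz)
      · have : T.arc (T.vtx f i) (T.vtx f (finRotate _ i)) '' Icc 0 1 ⊆ frontier Ω := by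
          rw [← closure_Ioo zero_ne_one]
          refine (ContinuousOn.image_closure ?_).trans (closure_minimal h1 isClosed_frontier)
          rw [closure_Ioo zero_ne_one]
          exact T.arc_continuousOn _ _ hadj
        exact this.trans hfc
    have hnot : ∀ u w : T.V, ∀ huw : T.graph.Adj u w, (∃ t ∈ Ioo (0 : ℝ) 1,
        T.arc u w t ∉ Ω) → (u : ℂ) ∉ Ω := by
      rintro u w huw ⟨t, ht, h1⟩ hu
      exact h1 (T.arc_subset_of_mem hΩ huw hu ⟨t, ht, rfl⟩)
    have h0 := hmem (T.vtx f i) ⟨0, ⟨le_rfl, zero_le_one⟩, T.arc_zero _ _ hadj⟩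
      (hnot _ _ hadj ⟨t, ht, hfc hz⟩)
    have h1 := hmem (T.vtx f (finRotate _ i)) ⟨1, ⟨zero_le_one, le_rfl⟩, T.arc_one _ _ hadj⟩
      (hnot _ _ hadj.symm ⟨1 - t, ⟨by linarith [ht.2], by linarith [ht.1]⟩, by
        rw [T.arc_symm _ _ hadj _ ⟨by linarith [ht.2], by linarith [ht.1]⟩, sub_sub_cancel]
        exact hfc hz⟩)
    rw [hgbar.apply_arc hadj ⟨ht.1.le, ht.2.le⟩, h0, h1]; ring
  · rw [T.chart_corner] at hz h ⊢
    rw [hgbar.vertex]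
    exact h _ hz rfl

variable {c : T.V → T.V → ℝ} {k : ℝ}

theorem IsDirichletSolution.apply_outer (hg : T.IsDirichletSolution c k g)
    (hgbar : T.IsAffineExtension g gbar) (hΩ : IsOpen Ω) {z : ℂ} (hz : z ∈ outerBoundary Ω) :
    gbar z = k :=
  hgbar.eq_of_mem_frontier hΩ hz.1 fun u hu h => hg.outer u ⟨hu, by rw [h]; exact hz.2⟩

theorem IsDirichletSolution.apply_inner (hg : T.IsDirichletSolution c k g)
    (hgbar : T.IsAffineExtension g gbar) (hΩ : IsOpen Ω) {z : ℂ} (hz : z ∈ innerBoundary Ω) :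
    gbar z = 0 :=
  hgbar.eq_of_mem_frontier hΩ hz.1 fun u hu h => hg.inner u ⟨hu, by rw [h]; exact hz.2⟩

/-- The extension is not constant on any `2`-cell: otherwise all sides of this cell lie in the
boundary, and the open cell is all of `Ω`. -/
theorem IsAffineExtension.exists_ne_corner (hgbar : T.IsAffineExtension g gbar) (hΩ : IsOpen Ω)
    (cΩ : IsPreconnected Ω) (hsep : T.SeparatesAdjacent g)
    (hne : ∃ x ∈ closure Ω, ∃ y ∈ closure Ω, gbar x ≠ gbar y) (f : T.F) :
    ∃ i j, g (T.vtx f i) ≠ g (T.vtx f j) := by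
  by_contra! hcon
  have hFin := T.finite_F
  have hfc : ∀ x ∈ frontier Ω, x ∉ Ω := fun x hx hx' => by
    rw [hΩ.frontier_eq] at hx; exact hx.2 hx'
  have hside : ∀ i, T.arc (T.vtx f i) (T.vtx f (finRotate _ i)) '' Ioo 0 1 ⊆ frontier Ω := by
    intro i
    rcases T.edge_subset _ _ (T.side_adj f i) with h | h
    · exact absurd (hcon _ _) (hsep _ _ (T.side_adj f i) h)
    · exact h
  have hint : ∀ ζ ∈ T.poly f, T.chart f ζ ∈ Ω → ζ ∈ interior (T.poly f) := by
    intro ζ hζ hΩζ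
    rcases T.mem_poly_cases hζ with h | ⟨i, t, ht, -, h⟩ | ⟨i, rfl⟩
    · exact h
    · exact absurd hΩζ (hfc _ (hside i ⟨t, ht, h.symm⟩))
    · rw [T.chart_corner] at hΩζ
      have h1 : (1 / 2 : ℝ) ∈ Ioo (0 : ℝ) 1 := by constructor <;> norm_num
      exact absurd (T.arc_subset_of_mem hΩ (T.side_adj f i) hΩζ ⟨_, h1, rfl⟩)
        (hfc _ (hside i ⟨_, h1, rfl⟩))
  obtain ⟨ζ₀, hζ₀⟩ := (T.corner_convex f).interior_nonempty (T.sides_eq f)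
  -- Otherwise the closed cell and the union of the other cells would be closed sets covering the
  -- connected `Ω` and both meeting it, hence would share a point of `Ω`; such a point is interior
  -- to the cell `f`.
  have hcl : closure Ω ⊆ T.chart f '' T.poly f := by
    refine closure_minimal ?_ (T.isCompact_image_poly f).isClosed
    by_contra hsub
    obtain ⟨z, hz, hzf⟩ := not_subset.1 hsub
    have hclosed : IsClosed (⋃ f' : {f' : T.F // f' ≠ f}, T.chart f' '' T.poly f') :=
      isClosed_iUnion_of_finite fun f' => (T.isCompact_image_poly _).isClosed
    have hcov : Ω ⊆ T.chart f '' T.poly f ∪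
        ⋃ f' : {f' : T.F // f' ≠ f}, T.chart f' '' T.poly f' := by
      intro w hw
      obtain ⟨f', ζ, hζ, rfl⟩ := T.exists_face (subset_closure hw)
      by_cases hf : f' = f
      · subst hf; exact Or.inl ⟨ζ, hζ, rfl⟩
      · exact Or.inr (mem_iUnion.2 ⟨⟨f', hf⟩, ζ, hζ, rfl⟩)
    obtain ⟨w, hw, ⟨ζ, hζ, rfl⟩, hw2⟩ := isPreconnected_closed_iff.1 cΩ _ _
      (T.isCompact_image_poly f).isClosed hclosed hcov
      ⟨T.chart f ζ₀, T.face_subset f ⟨ζ₀, hζ₀, rfl⟩, ζ₀, interior_subset hζ₀, rfl⟩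
      ⟨z, hz, (hcov hz).resolve_left hzf⟩
    obtain ⟨⟨f', hf'⟩, ζ', hζ', he⟩ := mem_iUnion.1 hw2
    exact hf' (T.face_eq_of_mem_interior (hint ζ hζ hw) hζ' he.symm)
  obtain ⟨A, hA, hAi⟩ := hgbar.exists_affine f
  have hconst : ∀ z ∈ closure Ω, gbar z = g (T.vtx f ⟨0, by
      rcases T.sides_eq f with h | h <;> omega⟩) := by
    intro z hz
    obtain ⟨ζ, hζ, rfl⟩ := hcl hz
    rw [hA ζ hζ]
    refine le_antisymm ?_ (le_of_le_corner A (fun j => ?_) hζ)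
    · have := le_of_le_corner (p := T.corner f) (-A) (m := -g (T.vtx f ⟨0, by
        rcases T.sides_eq f with h | h <;> omega⟩)) (fun j => ?_) hζ
      · simpa using this
      · simp only [AffineMap.coe_neg, Pi.neg_apply, hAi]
        exact (congrArg Neg.neg (hcon _ _)).le
    · rw [hAi]; exact (hcon _ _).le
  obtain ⟨x, hx, y, hy, hxy⟩ := hne
  exact hxy ((hconst x hx).trans (hconst y hy).symm)

end Boundary

/-! ### The cells around a vertex -/

theorem sector_corner {v : T.V} (hv : (v : ℂ) ∈ Ω) (i : Fin (T.deg v)) :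
    ∃ j, T.vtx (T.sector v i) j = v ∧ ∀ w, (w = T.nbr v i ∨ w = T.nbr v (finRotate _ i)) ↔
      (w = T.vtx (T.sector v i) ((finRotate _).symm j) ∨
        w = T.vtx (T.sector v i) (finRotate _ j)) := by
  obtain ⟨j, h1, h2⟩ := T.sector_sides v hv i
  refine ⟨j, h1, fun w => ?_⟩
  have := Set.ext_iff.1 h2 w
  simpa only [mem_insert_iff, mem_singleton_iff] using this.symm

theorem nbr_adj {v : T.V} (hv : (v : ℂ) ∈ Ω) (i : Fin (T.deg v)) : T.graph.Adj v (T.nbr v i) :=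
  (T.nbr_bijOn v hv).mapsTo (mem_univ i)

theorem exists_nbr_eq {v w : T.V} (hv : (v : ℂ) ∈ Ω) (h : T.graph.Adj v w) :
    ∃ i, T.nbr v i = w := by
  obtain ⟨i, -, hi⟩ := (T.nbr_bijOn v hv).surjOn h
  exact ⟨i, hi⟩

theorem exists_sector_eq {v : T.V} (hv : (v : ℂ) ∈ Ω) {f : T.F} (h : v ∈ range (T.vtx f)) :
    ∃ i, T.sector v i = f := by
  obtain ⟨i, -, hi⟩ := (T.sector_bijOn v hv).surjOn h
  exact ⟨i, hi⟩

theorem exists_chart_eq_arc {v : T.V} (hv : (v : ℂ) ∈ Ω) {i : Fin (T.deg v)} {w : T.V}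
    (hw : w = T.nbr v i ∨ w = T.nbr v (finRotate _ i)) {t : ℝ} (ht : t ∈ Icc (0 : ℝ) 1) :
    ∃ ζ ∈ T.poly (T.sector v i), T.chart (T.sector v i) ζ = T.arc v w t := by
  obtain ⟨j, hj, hiff⟩ := sector_corner hv i
  rcases (hiff w).1 hw with rfl | rfl
  -- This side of the cell ends at `v`, so it is traversed backwards.
  · refine ⟨_, T.side_mem _ ((finRotate _).symm j) (t := 1 - t)
      ⟨by linarith [ht.2], by linarith [ht.1]⟩, ?_⟩
    have hadj := T.side_adj (T.sector v i) ((finRotate _).symm j)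
    rw [T.chart_side _ _ _ ⟨by linarith [ht.2], by linarith [ht.1]⟩]
    rw [Equiv.apply_symm_apply, hj] at hadj ⊢
    exact (T.arc_symm _ _ hadj t ht).symm
  · refine ⟨_, T.side_mem _ j ht, ?_⟩
    rw [T.chart_side _ _ _ ht, hj]

variable {g : T.V → ℝ} {gbar : ℂ → ℝ}

theorem exists_vtx_sector {v : T.V} (hv : (v : ℂ) ∈ Ω) {i : Fin (T.deg v)} {w : T.V}
    (hw : w = T.nbr v i ∨ w = T.nbr v (finRotate _ i)) : ∃ l, T.vtx (T.sector v i) l = w := by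
  obtain ⟨j, hj, hiff⟩ := sector_corner hv i
  rcases (hiff w).1 hw with rfl | rfl
  exacts [⟨_, rfl⟩, ⟨_, rfl⟩]

/-- If both sides of the sector at `v` ascend, `corner_le` makes `v` the minimum of the sector. -/
theorem IsAffineExtension.exists_nbr_lt (hgbar : T.IsAffineExtension g gbar) {v : T.V}
    (hv : (v : ℂ) ∈ Ω) {i : Fin (T.deg v)} {ζ : ℂ} (hζ : ζ ∈ T.poly (T.sector v i))
    (hlt : gbar (T.chart (T.sector v i) ζ) < g v) :
    g (T.nbr v i) < g v ∨ g (T.nbr v (finRotate _ i)) < g v := by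
  by_contra! hcon
  obtain ⟨A, hA, hAi⟩ := hgbar.exists_affine (T.sector v i)
  obtain ⟨j, hj, hiff⟩ := sector_corner hv i
  have hge : ∀ w, (w = T.vtx (T.sector v i) ((finRotate _).symm j) ∨
        w = T.vtx (T.sector v i) (finRotate _ j)) → g v ≤ g w := by
    intro w hw
    rcases (hiff w).2 hw with rfl | rfl
    exacts [hcon.1, hcon.2]
  have := (T.corner_convex _).corner_le (T.sides_eq _) A j
    (by rw [hAi, hAi, hj]; exact hge _ (Or.inr rfl))
    (by rw [hAi, hAi, hj]; exact hge _ (Or.inl rfl)) hζ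
  rw [hAi, hj, ← hA ζ hζ] at this
  linarith

theorem SeparatesAdjacent.nbr_sub_ne (hsep : T.SeparatesAdjacent g) (hΩ : IsOpen Ω) {v : T.V}
    (hv : (v : ℂ) ∈ Ω) (i : Fin (T.deg v)) : g (T.nbr v i) - g v ≠ 0 :=
  sub_ne_zero.2 (hsep _ _ (nbr_adj hv i) (T.arc_subset_of_mem hΩ (nbr_adj hv i) hv)).symm

-- This form shows that the index vanishes exactly when the cyclic sequence turns upwards once.
open scoped Classical in
theorem SeparatesAdjacent.index_eq (hsep : T.SeparatesAdjacent g) (hΩ : IsOpen Ω) {v : T.V}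
    (hv : (v : ℂ) ∈ Ω) : T.index g v = 1 - ((Finset.univ.filter fun i : Fin (T.deg v) =>
      g (T.nbr v i) - g v < 0 ∧ 0 < g (T.nbr v (finRotate _ i)) - g v).card : ℝ) := by
  have := card_signChanges_eq (a := fun i => g (T.nbr v i) - g v) (hsep.nbr_sub_ne hΩ hv)
  unfold index signChanges
  rw [this]
  push_cast
  ring

/-- Close to a point which is not a singular vertex, the points below its level are linked
below this level. -/
theorem IsAffineExtension.eventually_linkedIn (hgbar : T.IsAffineExtension g gbar) (hΩ : IsOpen Ω)
    (hsep : T.SeparatesAdjacent g) {p : ℂ} (hp : p ∈ Ω)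
    (hns : ∀ v : T.V, (v : ℂ) = p → ¬ T.IsSingularVertex g v) :
    ∃ N ∈ 𝓝 p, ∀ x ∈ N, ∀ y ∈ N, x ∈ closure Ω → y ∈ closure Ω → gbar x < gbar p →
      gbar y < gbar p → LinkedIn {w ∈ closure Ω | gbar w < gbar p} x y := by
  classical
  refine ⟨_, T.eventually_mem_face p, ?_⟩
  -- It suffices to link all lower points of the cells at `p` to one point `r`: a point of the cell,
  -- the lower end of the edge, or a lower neighbor, according to the position of `p`.
  suffices H : ∃ r : ℂ, (∃ f, ∃ ζ ∈ T.poly f, p ∈ T.chart f '' T.poly f ∧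
      gbar (T.chart f ζ) < gbar p) → ∀ f, ∀ ζ ∈ T.poly f, p ∈ T.chart f '' T.poly f →
      gbar (T.chart f ζ) < gbar p →
      LinkedIn {w ∈ closure Ω | gbar w < gbar p} (T.chart f ζ) r by
    obtain ⟨r, hr⟩ := H
    intro x hx y hy hxc hyc hxp hyp
    obtain ⟨f, ζ, hζ, rfl⟩ := T.exists_face hxc
    obtain ⟨f', ζ', hζ', rfl⟩ := T.exists_face hyc
    have hpf := hx f ⟨ζ, hζ, rfl⟩
    have hpf' := hy f' ⟨ζ', hζ', rfl⟩
    have := hr ⟨f, ζ, hζ, hpf, hxp⟩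
    exact (this f ζ hζ hpf hxp).trans (this f' ζ' hζ' hpf' hyp).symm
  obtain ⟨f₀, ζ₀, hζ₀, rfl⟩ := T.exists_face (subset_closure hp)
  rcases T.mem_poly_cases hζ₀ with h | ⟨i, t, ht, -, h⟩ | ⟨i, rfl⟩
  · by_cases hex : ∃ ξ ∈ T.poly f₀, gbar (T.chart f₀ ξ) < gbar (T.chart f₀ ζ₀)
    · obtain ⟨ξ, hξ, hlt⟩ := hex
      refine ⟨T.chart f₀ ξ, fun _ f ζ hζ hpf hζlt => ?_⟩
      obtain ⟨ζ', hζ', he⟩ := hpf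
      obtain rfl := T.face_eq_of_mem_interior h hζ' he.symm
      exact hgbar.linkedIn_face_lt hζ hξ hζlt hlt
    · refine ⟨0, fun _ f ζ hζ hpf hζlt => ?_⟩
      obtain ⟨ζ', hζ', he⟩ := hpf
      obtain rfl := T.face_eq_of_mem_interior h hζ' he.symm
      exact absurd ⟨ζ, hζ, hζlt⟩ hex
  · have hadj := T.side_adj f₀ i
    have hne := hsep _ _ hadj (by
      rcases T.edge_subset _ _ hadj with h' | h'
      · exact h'
      · have := h' ⟨t, ht, h.symm⟩
        rw [hΩ.frontier_eq] at this
        exact absurd hp this.2)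
    have hv : gbar (T.chart f₀ ζ₀) = _ := (congrArg gbar h).trans
      (hgbar.apply_arc hadj ⟨ht.1.le, ht.2.le⟩)
    obtain ⟨r, hr, hrlt⟩ : ∃ r, (r = T.vtx f₀ i ∨ r = T.vtx f₀ (finRotate _ i)) ∧
        g r < gbar (T.chart f₀ ζ₀) := by
      rcases hne.lt_or_gt with h' | h'
      · exact ⟨_, Or.inl rfl, by rw [hv]; nlinarith [ht.1, ht.2]⟩
      · exact ⟨_, Or.inr rfl, by rw [hv]; nlinarith [ht.1, ht.2]⟩
    refine ⟨r, fun _ f ζ hζ hpf hζlt => ?_⟩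
    obtain ⟨ζ', hζ', he⟩ := hpf
    obtain ⟨j, hj⟩ := T.side_of_chart_eq_arc hζ' hadj ht (he.trans h)
    obtain ⟨l, hl⟩ : ∃ l, T.vtx f l = r := by
      rcases adj_cases hj with ⟨h1, h2⟩ | ⟨h1, h2⟩ <;> rcases hr with rfl | rfl
      exacts [⟨_, h1.symm⟩, ⟨_, h2.symm⟩, ⟨_, h1.symm⟩, ⟨_, h2.symm⟩]
    rw [← hl, ← T.chart_corner]
    refine hgbar.linkedIn_face_lt hζ (T.corner_mem f l) hζlt ?_
    rwa [T.chart_corner, hl, hgbar.vertex]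
  · rw [T.chart_corner] at hp hns ⊢
    set v := T.vtx f₀ i with hvdef
    have hns' : T.index g v = 0 := by
      by_contra hne
      exact hns v rfl ⟨hp, hne⟩
    rw [hsep.index_eq hΩ hp, sub_eq_zero, eq_comm, Nat.cast_eq_one, Finset.card_eq_one] at hns'
    obtain ⟨b, hb⟩ := hns'
    have hbU := Finset.ext_iff.1 hb
    simp only [Finset.mem_filter, Finset.mem_univ, true_and, Finset.mem_singleton] at hbU
    have hb1 := (hbU b).2 rfl
    have hnbr : ∀ (i : Fin (T.deg v)) (ζ : ℂ) (w : T.V), (w = T.nbr v i ∨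
        w = T.nbr v (finRotate _ i)) → ζ ∈ T.poly (T.sector v i) →
        gbar (T.chart (T.sector v i) ζ) < g v → g w < g v →
        LinkedIn {w ∈ closure Ω | gbar w < gbar v} (T.chart (T.sector v i) ζ) w := by
      intro i ζ w hw hζ hlt hwlt
      obtain ⟨l, rfl⟩ := exists_vtx_sector hp hw
      rw [← T.chart_corner (T.sector v i) l]
      refine hgbar.linkedIn_face_lt (t := gbar v) hζ (T.corner_mem _ l) (by rwa [hgbar.vertex]) ?_
      rwa [T.chart_corner, hgbar.vertex, hgbar.vertex]
    -- The lower neighbors form a single run ending at `b`. Going backwards from `b`, consecutive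
    -- lower neighbors are linked through their common sector.
    have hlink : ∀ i, g (T.nbr v i) < g v →
        LinkedIn {w ∈ closure Ω | gbar w < gbar v} (T.nbr v i : ℂ) (T.nbr v b) := by
      intro i
      refine finRotate_symm_induction (Q := fun i => g (T.nbr v i) < g v →
        LinkedIn {w ∈ closure Ω | gbar w < gbar v} (T.nbr v i : ℂ) (T.nbr v b)) ?_ (i₀ := b) ?_ i
      · intro i ih hi
        by_cases hi' : g (T.nbr v (finRotate _ i)) < g v
        · refine LinkedIn.trans ?_ (ih hi')
          obtain ⟨l, hl⟩ := exists_vtx_sector (i := i) hp (Or.inl rfl)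
          have := hnbr i (T.corner _ l) _ (Or.inr rfl) (T.corner_mem _ l)
            (by rwa [T.chart_corner, hl, hgbar.vertex]) hi'
          rwa [T.chart_corner, hl] at this
        · have hne := hsep.nbr_sub_ne hΩ hp (finRotate _ i)
          have : i = b := (hbU i).1 ⟨by linarith, lt_of_le_of_ne (by linarith) hne.symm⟩
          subst this
          exact LinkedIn.refl ⟨T.vertex_mem _, by rwa [hgbar.vertex, hgbar.vertex]⟩
      · intro hb
        exact LinkedIn.refl ⟨T.vertex_mem _, by rwa [hgbar.vertex, hgbar.vertex]⟩
    refine ⟨T.nbr v b, fun _ f ζ hζ hpf hζlt => ?_⟩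
    obtain ⟨ζ', hζ', he⟩ := hpf
    obtain ⟨l, -, hl⟩ := T.eq_corner_of_chart_eq_vertex hζ' he
    obtain ⟨i, rfl⟩ := exists_sector_eq hp ⟨l, hl⟩
    rw [hgbar.vertex] at hζlt
    rcases hgbar.exists_nbr_lt hp hζ hζlt with h | h
    · exact (hnbr i ζ _ (Or.inl rfl) hζ hζlt h).trans (hlink _ h)
    · exact (hnbr i ζ _ (Or.inr rfl) hζ hζlt h).trans (hlink _ h)

end CellDecomposition

/-! ### Excluding singular vertices above the critical level. -/

namespace CellDecomposition

variable {Ω : Set ℂ} {T : CellDecomposition Ω} {g : T.V → ℝ} {gbar : ℂ → ℝ}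

/-- An edge descending through the level `s` crosses it exactly once. -/
theorem IsAffineExtension.exists_crossing (hgbar : T.IsAffineExtension g gbar) {u v : T.V}
    (huv : T.graph.Adj u v) {s : ℝ} (hu : s < g u) (hv : g v < s) :
    ∃ τ ∈ Ioo (0 : ℝ) 1, ∀ t ∈ Icc (0 : ℝ) 1, (gbar (T.arc u v t) ≤ s ↔ τ ≤ t) := by
  have hpos : 0 < g u - g v := by linarith
  refine ⟨(g u - s) / (g u - g v), ⟨div_pos (by linarith) hpos, ?_⟩, fun t ht => ?_⟩
  · rw [div_lt_one hpos]; linarith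
  · rw [hgbar.apply_arc huv ht, div_le_iff₀ hpos]
    constructor <;> intro h <;> nlinarith

/-- If a point of a closed `2`-cell lies above the level `r`, so does a point of the open `2`-cell. -/
theorem IsAffineExtension.exists_interior_gt (hgbar : T.IsAffineExtension g gbar) {f : T.F} {ζ : ℂ}
    (hζ : ζ ∈ T.poly f) {r : ℝ} (hr : r < gbar (T.chart f ζ)) :
    ∃ ξ ∈ interior (T.poly f), r < gbar (T.chart f ξ) := by
  obtain ⟨A, hA, -⟩ := hgbar.exists_affine f
  obtain ⟨ξ₀, hξ₀⟩ := (T.corner_convex f).interior_nonempty (T.sides_eq f)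
  have hcl : ζ ∈ closure (interior (T.poly f)) := by
    rw [(T.convex_poly f).closure_interior_eq_closure_of_nonempty_interior ⟨ξ₀, hξ₀⟩]
    exact subset_closure hζ
  have hopen : IsOpen (A ⁻¹' Ioi r) := isOpen_Ioi.preimage A.continuous_of_finiteDimensional
  obtain ⟨ξ, h1, h2⟩ := mem_closure_iff.1 hcl _ hopen (by rw [hA ζ hζ] at hr; exact hr)
  exact ⟨ξ, h2, by rw [hA ξ (interior_subset h2)]; exact h1⟩

/-- A singular vertex at which the superlevel set is connected and the slightly lower sublevel sets
are connected is impossible: two edges descending from it into different sectors, together with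
a connected sublevel set, would separate the plane. -/
theorem IsAffineExtension.not_isSingularVertex (hgbar : T.IsAffineExtension g gbar)
    (hΩ : IsOpen Ω) (hsep : T.SeparatesAdjacent g) (hh : T.HasHigherNeighbors g)
    (hl : T.HasHigherNeighbors (-g)) {G : ℂ → ℝ}
    (hGe : ∀ z ∈ closure Ω, G z = gbar z) {v : T.V} {s₀ : ℝ} (hs₀ : s₀ < g v)
    (hout : ∀ z ∉ Ω, G z ≤ s₀ ∨ g v < G z)
    (hcpt : ∀ s, s₀ ≤ s → s < g v → IsCompact {z | G z ≤ s})
    (hpre : ∀ s, s₀ ≤ s → s < g v → IsPreconnected {z | G z ≤ s})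
    (hconn : IsPreconnected {z | g v < G z}) : ¬ T.IsSingularVertex g v := by
  classical
  rintro ⟨hv, hindex⟩
  have hGv : ∀ u : T.V, G u = g u := fun u => by rw [hGe _ (T.vertex_mem u), hgbar.vertex]
  have hGf : ∀ f, ∀ ζ ∈ T.poly f, G (T.chart f ζ) = gbar (T.chart f ζ) :=
    fun f ζ hζ => hGe _ (T.chart_mem_closure hζ)
  have hGa : ∀ u w, T.graph.Adj u w → ∀ t ∈ Icc (0 : ℝ) 1, G (T.arc u w t) = gbar (T.arc u w t) :=
    fun u w huw t ht => hGe _ (T.arc_subset_closure huw ht)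
  -- two descending edges followed by ascending ones
  have hne := hsep.nbr_sub_ne hΩ hv
  obtain ⟨iu, hiu⟩ : ∃ i, 0 < g (T.nbr v i) - g v := by
    obtain ⟨w, hw, hlt⟩ := hh v hv
    obtain ⟨i, rfl⟩ := exists_nbr_eq hv hw
    exact ⟨i, sub_pos.2 hlt⟩
  obtain ⟨id, hid⟩ : ∃ i, g (T.nbr v i) - g v < 0 := by
    obtain ⟨w, hw, hlt⟩ := hl v hv
    obtain ⟨i, rfl⟩ := exists_nbr_eq hv hw
    exact ⟨i, sub_neg.2 (neg_lt_neg_iff.1 hlt)⟩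
  rw [hsep.index_eq hΩ hv] at hindex
  -- There is at least one upward turn because both signs occur, and not exactly one because the
  -- index is nonzero.
  obtain ⟨b, b', hb, hb', hbb'⟩ : ∃ b b', (g (T.nbr v b) - g v < 0 ∧
      0 < g (T.nbr v (finRotate _ b)) - g v) ∧ (g (T.nbr v b') - g v < 0 ∧
      0 < g (T.nbr v (finRotate _ b')) - g v) ∧ b ≠ b' := by
    obtain ⟨b, hb⟩ := exists_neg_pos_finRotate hne ⟨id, hid⟩ ⟨iu, hiu⟩
    set U := Finset.univ.filter fun i : Fin (T.deg v) =>
      g (T.nbr v i) - g v < 0 ∧ 0 < g (T.nbr v (finRotate _ i)) - g v with hU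
    have hbU : b ∈ U := Finset.mem_filter.2 ⟨Finset.mem_univ _, hb⟩
    have h1 : U.card ≠ 1 := fun h => hindex (by rw [h]; norm_num)
    have h2 : 0 < U.card := Finset.card_pos.2 ⟨b, hbU⟩
    obtain ⟨x, hx, y, hy, hxy⟩ := Finset.one_lt_card.1 (show 1 < U.card by omega)
    exact ⟨x, y, (Finset.mem_filter.1 hx).2, (Finset.mem_filter.1 hy).2, hxy⟩
  -- a level `s` just below
  obtain ⟨s, hs0, hsv, hsu⟩ : ∃ s, s₀ < s ∧ s < g v ∧ ∀ u : T.V, g u < g v → g u < s := by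
    have h1 : ∀ᶠ s in 𝓝[<] (g v), ∀ u : T.V, g u < g v → g u < s := by
      rw [eventually_all]
      intro u
      by_cases hu : g u < g v
      · filter_upwards [mem_nhdsWithin_of_mem_nhds (lt_mem_nhds hu)] with s hs _ using hs
      · exact Eventually.of_forall fun _ h => absurd h hu
    have h2 : ∀ᶠ s in 𝓝[<] (g v), s₀ < s := mem_nhdsWithin_of_mem_nhds (lt_mem_nhds hs₀)
    obtain ⟨s, ⟨h3, h4⟩, h5⟩ := ((h1.and h2).and self_mem_nhdsWithin).exists
    exact ⟨s, h4, h5, h3⟩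
  have hadj := nbr_adj hv
  obtain ⟨τ, hτ, hτs⟩ := hgbar.exists_crossing (hadj b) hsv (hsu _ (sub_neg.1 hb.1))
  obtain ⟨τ', hτ', hτs'⟩ := hgbar.exists_crossing (hadj b') hsv (hsu _ (sub_neg.1 hb'.1))
  set γ := T.arc v (T.nbr v b) with hγ
  set γ' := T.arc v (T.nbr v b') with hγ'
  have hI : Icc 0 τ ⊆ Icc (0 : ℝ) 1 := Icc_subset_Icc_right hτ.2.le
  have hI' : Icc 0 τ' ⊆ Icc (0 : ℝ) 1 := Icc_subset_Icc_right hτ'.2.le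
  have hcγ : ContinuousOn γ (Icc 0 τ) := (T.arc_continuousOn _ _ (hadj b)).mono hI
  have hcγ' : ContinuousOn γ' (Icc 0 τ') := (T.arc_continuousOn _ _ (hadj b')).mono hI'
  have hγ0 : γ 0 = v := T.arc_zero _ _ (hadj b)
  have hγ0' : γ' 0 = v := T.arc_zero _ _ (hadj b')
  have hnb : T.nbr v b ≠ T.nbr v b' := fun h =>
    hbb' ((T.nbr_bijOn v hv).injOn (mem_univ _) (mem_univ _) h)
  -- `Y` consists of the two descending edges cut off where they enter `X`, so the two continua meet
  -- in exactly two points.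
  set X := {z | G z ≤ s} with hX
  set Y := γ '' Icc 0 τ ∪ γ' '' Icc 0 τ' with hY
  have hYX : X ∩ Y = {γ τ, γ' τ'} := by
    ext z
    constructor
    · rintro ⟨hzX, ⟨t, ht, rfl⟩ | ⟨t, ht, rfl⟩⟩
      · have h1 : gbar (γ t) ≤ s := by rw [← hGa _ _ (hadj b) t (hI ht)]; exact hzX
        have := (hτs t (hI ht)).1 h1
        rw [le_antisymm ht.2 this]; exact Or.inl rfl
      · have h1 : gbar (γ' t) ≤ s := by rw [← hGa _ _ (hadj b') t (hI' ht)]; exact hzX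
        have := (hτs' t (hI' ht)).1 h1
        rw [le_antisymm ht.2 this]; exact Or.inr rfl
    · rintro (rfl | rfl)
      · refine ⟨?_, Or.inl ⟨τ, ⟨hτ.1.le, le_rfl⟩, rfl⟩⟩
        have := (hτs τ ⟨hτ.1.le, hτ.2.le⟩).2 le_rfl
        rwa [← hGa _ _ (hadj b) τ ⟨hτ.1.le, hτ.2.le⟩] at this
      · refine ⟨?_, Or.inr ⟨τ', ⟨hτ'.1.le, le_rfl⟩, rfl⟩⟩
        have := (hτs' τ' ⟨hτ'.1.le, hτ'.2.le⟩).2 le_rfl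
        rwa [← hGa _ _ (hadj b') τ' ⟨hτ'.1.le, hτ'.2.le⟩] at this
  have hpq : γ τ ≠ γ' τ' := by
    intro h
    refine Set.disjoint_left.1 (T.edge_disjoint_edge _ _ _ _ (hadj b) (hadj b') ?_) ⟨τ, hτ, rfl⟩
      ⟨τ', hτ', h.symm⟩
    intro h
    rcases adj_cases h with ⟨-, h⟩ | ⟨-, h⟩
    · exact hnb h
    · exact (hadj b).ne h.symm
  have cY : IsPreconnected Y := (isPreconnected_Icc.image _ hcγ).union (v : ℂ)
    ⟨0, ⟨le_rfl, hτ.1.le⟩, hγ0⟩ ⟨0, ⟨le_rfl, hτ'.1.le⟩, hγ0'⟩ (isPreconnected_Icc.image _ hcγ')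
  have hYcpt : IsCompact Y :=
    (isCompact_Icc.image_of_continuousOn hcγ).union (isCompact_Icc.image_of_continuousOn hcγ')
  refine not_isPreconnected_compl_union (hcpt s hs0.le hsv) hYcpt (hpre s hs0.le hsv) cY hpq hYX ?_
  -- the complement is connected
  have hYcases : ∀ y ∈ Y, y = v ∨ ∃ i, (i = b ∨ i = b') ∧ ∃ t ∈ Ioo (0 : ℝ) 1,
      y = T.arc v (T.nbr v i) t := by
    rintro y (⟨t, ht, rfl⟩ | ⟨t, ht, rfl⟩)
    · rcases ht.1.eq_or_lt with rfl | h0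
      · exact Or.inl hγ0
      · exact Or.inr ⟨b, Or.inl rfl, t, ⟨h0, ht.2.trans_lt hτ.2⟩, rfl⟩
    · rcases ht.1.eq_or_lt with rfl | h0
      · exact Or.inl hγ0'
      · exact Or.inr ⟨b', Or.inr rfl, t, ⟨h0, ht.2.trans_lt hτ'.2⟩, rfl⟩
  have hYle : ∀ y ∈ Y, G y ≤ g v := by
    intro y hy
    rcases hYcases y hy with rfl | ⟨i, hi, t, ht, rfl⟩
    · exact (hGv v).le
    · have hti : t ∈ Icc (0 : ℝ) 1 := ⟨ht.1.le, ht.2.le⟩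
      have : g (T.nbr v i) < g v := by
        rcases hi with rfl | rfl
        exacts [sub_neg.1 hb.1, sub_neg.1 hb'.1]
      rw [hGa _ _ (hadj i) t hti, hgbar.apply_arc (hadj i) hti]
      nlinarith [ht.1]
  set W := (X ∪ Y)ᶜ with hW
  have hWmem : ∀ z, z ∈ W ↔ s < G z ∧ z ∉ Y := by
    intro z
    rw [hW, mem_compl_iff, mem_union, not_or, hX, mem_ofPred_eq, not_le]
  have hhigh : {z | g v < G z} ⊆ W := fun z hz =>
    (hWmem z).2 ⟨hsv.trans hz, fun hzY => absurd (hYle z hzY) (not_le.2 hz)⟩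
  have hintW : ∀ f, ∀ ξ ∈ interior (T.poly f), s < gbar (T.chart f ξ) → T.chart f ξ ∈ W := by
    intro f ξ hξ hlt
    refine (hWmem _).2 ⟨by rwa [hGf f ξ (interior_subset hξ)], fun hmem => ?_⟩
    rcases hYcases _ hmem with h | ⟨i, -, t, ht, h⟩
    · exact T.vertex_notMem_face v f ⟨ξ, hξ, h⟩
    · exact Set.disjoint_left.1 (T.edge_disjoint_face _ _ f (hadj i)) ⟨t, ht, rfl⟩ ⟨ξ, hξ, h⟩
  have hlink : ∀ f, ∀ ζ ∈ T.poly f, T.chart f ζ ∈ W → ∀ ξ ∈ interior (T.poly f),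
      s < gbar (T.chart f ξ) → LinkedIn W (T.chart f ζ) (T.chart f ξ) := by
    intro f ζ hζ hζW ξ hξ hlt
    obtain ⟨A, hA, -⟩ := hgbar.exists_affine f
    have hseg : segment ℝ ζ ξ ⊆ T.poly f := (T.convex_poly f).segment_subset hζ (interior_subset hξ)
    refine ((convex_segment ζ ξ).isPreconnected.image (T.chart f)
      ((T.chart_continuousOn f).mono hseg)).linkedIn ?_ ⟨ζ, left_mem_segment ℝ _ _, rfl⟩
      ⟨ξ, right_mem_segment ℝ _ _, rfl⟩
    rintro _ ⟨η, hη, rfl⟩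
    have h1 := (((hWmem _).1 hζW).1)
    rw [hGf f ζ hζ] at h1
    have h3 : s < gbar (T.chart f η) := by
      rw [hA η (hseg hη)]
      have hc : Convex ℝ (A ⁻¹' Ioi s) := (convex_Ioi s).affine_preimage A
      rw [hA ζ hζ] at h1
      rw [hA ξ (interior_subset hξ)] at hlt
      exact hc.segment_subset h1 hlt hη
    rw [← insert_endpoints_openSegment] at hη
    rcases hη with rfl | rfl | hη
    · exact hζW
    · exact hintW f _ hξ h3
    · exact hintW f _ ((T.convex_poly f).openSegment_self_interior_subset_interior hζ hξ hη) h3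
  -- From a good cell one can escape to `{G > g v}` without meeting `X ∪ Y`. Goodness passes between
  -- closed cells sharing a point of `W`.
  let Good : T.F → Prop := fun f => ∀ ξ ∈ interior (T.poly f), s < gbar (T.chart f ξ) →
    ∃ y, g v < G y ∧ LinkedIn W (T.chart f ξ) y
  have hgood_high : ∀ f, (∃ i, g v < g (T.vtx f i)) → Good f := by
    rintro f ⟨i, hi⟩ ξ hξ hlt
    obtain ⟨η, hη, hηlt⟩ := hgbar.exists_interior_gt (T.corner_mem f i) (r := g v)
      (by rwa [T.chart_corner, hgbar.vertex])
    exact ⟨T.chart f η, by rwa [hGf f η (interior_subset hη)],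
      hlink f ξ (interior_subset hξ) (hintW f ξ hξ hlt) η hη (hsv.trans hηlt)⟩
  have hgood_step : ∀ f f' : T.F, Good f' → (∃ ζ ∈ T.poly f, ∃ ζ' ∈ T.poly f',
      T.chart f ζ = T.chart f' ζ' ∧ T.chart f ζ ∈ W) → Good f := by
    rintro f f' hf' ⟨ζ, hζ, ζ', hζ', he, hmem⟩ ξ hξ hlt
    have hs' : s < gbar (T.chart f' ζ') := by
      rw [← hGf f' ζ' hζ', ← he]; exact ((hWmem _).1 hmem).1
    obtain ⟨η, hη, hηlt⟩ := hgbar.exists_interior_gt hζ' hs'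
    obtain ⟨y, hy, hly⟩ := hf' η hη hηlt
    refine ⟨y, hy, ((hlink f ζ hζ hmem ξ hξ hlt).symm.trans ?_).trans hly⟩
    rw [he] at hmem ⊢
    exact hlink f' ζ' hζ' hmem η hη hηlt
  have hgood_sector : ∀ i, Good (T.sector v i) := by
    intro i
    have hpos : ∀ i w, (w = T.nbr v i ∨ w = T.nbr v (finRotate _ i)) → g v < g w →
        Good (T.sector v i) := by
      intro i w hw hlt
      obtain ⟨l, rfl⟩ := exists_vtx_sector hv hw
      exact hgood_high _ ⟨l, hlt⟩
    -- Rotating around `v`, goodness crosses the separating edge unless that edge belongs to `Y`;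
    -- but after the edges `b` and `b'` the next neighbor is higher, so the new sector is good by
    -- itself.
    refine finRotate_induction (Q := fun i => Good (T.sector v i)) ?_ (i₀ := iu)
      (hpos iu _ (Or.inl rfl) (sub_pos.1 hiu)) i
    intro i hi
    by_cases h2 : g v < g (T.nbr v (finRotate _ (finRotate _ i)))
    · exact hpos _ _ (Or.inr rfl) h2
    by_cases h1 : g v < g (T.nbr v (finRotate _ i))
    · exact hpos _ _ (Or.inl rfl) h1
    set i' := finRotate _ i with hi'
    have hi'b : ∀ j, (j = b ∨ j = b') → i' ≠ j := by
      rintro j (rfl | rfl) h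
      · rw [h] at h2; exact h2 (sub_pos.1 hb.2)
      · rw [h] at h2; exact h2 (sub_pos.1 hb'.2)
    have hlt : g (T.nbr v i') < g v := by
      have := hne i'
      exact sub_neg.1 (lt_of_le_of_ne (by linarith) this)
    obtain ⟨τ₁, hτ₁, hτs₁⟩ := hgbar.exists_crossing (hadj i') hsv (hsu _ hlt)
    have ht : τ₁ / 2 ∈ Ioo (0 : ℝ) 1 := ⟨by linarith [hτ₁.1], by linarith [hτ₁.1, hτ₁.2]⟩
    have hti : τ₁ / 2 ∈ Icc (0 : ℝ) 1 := ⟨ht.1.le, ht.2.le⟩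
    obtain ⟨ζ, hζ, hζe⟩ := exists_chart_eq_arc hv (i := i) (Or.inr rfl) hti
    obtain ⟨ζ', hζ', hζe'⟩ := exists_chart_eq_arc hv (i := i') (Or.inl rfl) hti
    refine hgood_step _ _ hi ⟨ζ', hζ', ζ, hζ, hζe'.trans hζe.symm, ?_⟩
    rw [hζe', hWmem]
    constructor
    · rw [hGa _ _ (hadj i') _ hti]
      by_contra hcon
      have := (hτs₁ _ hti).1 (not_lt.1 hcon)
      linarith [hτ₁.1]
    · intro hmem
      rcases hYcases _ hmem with h | ⟨j, hj, t, ht', h⟩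
      · exact T.vertex_notMem_edge v _ _ (hadj i') ⟨_, ht, h⟩
      · refine Set.disjoint_left.1 (T.edge_disjoint_edge _ _ _ _ (hadj i') (hadj j) ?_)
          ⟨_, ht, rfl⟩ ⟨t, ht', h.symm⟩
        intro hs
        rcases adj_cases hs with ⟨-, h⟩ | ⟨-, h⟩
        · exact hi'b j hj ((T.nbr_bijOn v hv).injOn (mem_univ _) (mem_univ _) h)
        · exact (hadj i').ne h.symm
  -- No vertex value lies in `[s, g v)`, so some corner has value at least `g v`. A corner at level
  -- `g v` other than `v` is off `Y`, lies in `Ω`, and has a higher neighbor in an adjoining good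
  -- cell.
  have hgood : ∀ f, Good f := by
    intro f ξ hξ hlt
    obtain ⟨i, hi⟩ := hgbar.exists_corner_gt (interior_subset hξ) hlt
    have hge : g v ≤ g (T.vtx f i) := by
      by_contra hcon
      exact absurd (hsu _ (not_le.1 hcon)) (not_lt.2 hi.le)
    rcases hge.lt_or_eq with h | h
    · exact hgood_high f ⟨i, h⟩ ξ hξ hlt
    by_cases hu : T.vtx f i = v
    · obtain ⟨j, rfl⟩ := exists_sector_eq hv ⟨i, hu⟩
      exact hgood_sector j ξ hξ hlt
    have huΩ : (T.vtx f i : ℂ) ∈ Ω := by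
      by_contra hcon
      rcases hout _ hcon with h' | h' <;> rw [hGv] at h' <;> linarith
    obtain ⟨w, hw, hwlt⟩ := hh _ huΩ
    obtain ⟨f', j, hs⟩ := T.exists_side hw
    obtain ⟨a, c, ha, hc⟩ : ∃ a c, T.vtx f' a = T.vtx f i ∧ T.vtx f' c = w := by
      rcases adj_cases hs with ⟨h1, h2⟩ | ⟨h1, h2⟩
      exacts [⟨_, _, h1.symm, h2.symm⟩, ⟨_, _, h1.symm, h2.symm⟩]
    refine hgood_step f f' (hgood_high f' ⟨c, by rw [hc]; linarith⟩) ⟨_, T.corner_mem f i, _,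
      T.corner_mem f' a, by rw [T.chart_corner, T.chart_corner, ha], ?_⟩ ξ hξ hlt
    rw [T.chart_corner, hWmem, hGv]
    refine ⟨hi, fun hmem => ?_⟩
    rcases hYcases _ hmem with h' | ⟨j, -, t, ht, h'⟩
    · exact hu (Subtype.ext h')
    · exact T.vertex_notMem_edge _ _ _ (hadj j) ⟨t, ht, h'.symm⟩
  have hfinal : ∀ z ∈ W, ∃ y, g v < G y ∧ LinkedIn W z y := by
    intro z hz
    by_cases hzΩ : z ∈ Ω
    · obtain ⟨f, ζ, hζ, rfl⟩ := T.exists_face (subset_closure hzΩ)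
      have h1 := ((hWmem _).1 hz).1
      rw [hGf f ζ hζ] at h1
      obtain ⟨ξ, hξ, hlt⟩ := hgbar.exists_interior_gt hζ h1
      obtain ⟨y, hy, hly⟩ := hgood f ξ hξ hlt
      exact ⟨y, hy, (hlink f ζ hζ hz ξ hξ hlt).trans hly⟩
    · rcases hout z hzΩ with h | h
      · exact absurd ((hWmem _).1 hz).1 (not_lt.2 (h.trans hs0.le))
      · exact ⟨z, h, LinkedIn.refl hz⟩
  rw [isPreconnected_iff_linkedIn]
  intro x hx y hy
  obtain ⟨x', hx', hxx'⟩ := hfinal x hx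
  obtain ⟨y', hy', hyy'⟩ := hfinal y hy
  exact (hxx'.trans (hconn.linkedIn hhigh hx' hy')).trans hyy'.symm

end CellDecomposition

/-! ### Multiply connected regions -/

/-- Polar coordinates; negative radii do no harm, so no sign condition on `R` is needed. -/
theorem isPreconnected_compl_closedBall_zero (R : ℝ) :
    IsPreconnected (Metric.closedBall (0 : ℂ) R)ᶜ := by
  have h1 : IsPreconnected (Ioi R ×ˢ (univ : Set ℝ)) := isPreconnected_Ioi.prod isPreconnected_univ
  have h2 := h1.image (fun p : ℝ × ℝ => (p.1 : ℂ) * Complex.exp (p.2 * Complex.I))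
    (by fun_prop)
  convert h2 using 1
  ext z
  simp only [mem_compl_iff, Metric.mem_closedBall, dist_zero_right, not_le, mem_image, mem_prod,
    mem_Ioi, mem_univ, and_true, Prod.exists]
  constructor
  · intro hz
    exact ⟨‖z‖, z.arg, hz, Complex.norm_mul_exp_arg_mul_I z⟩
  · rintro ⟨r, θ, hr, rfl⟩
    rw [norm_mul, Complex.norm_exp_ofReal_mul_I, mul_one, Complex.norm_real, Real.norm_eq_abs]
    exact hr.trans_le (le_abs_self r)

theorem not_isBounded_of_compl_closedBall_subset {S : Set ℂ} {R : ℝ}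
    (h : (Metric.closedBall (0 : ℂ) R)ᶜ ⊆ S) : ¬ Bornology.IsBounded S := by
  intro hb
  have : Bornology.IsBounded (univ : Set ℂ) := by
    rw [← compl_union_self (Metric.closedBall (0 : ℂ) R)]
    exact (hb.subset h).union Metric.isBounded_closedBall
  exact NormedSpace.unbounded_univ ℝ ℂ this

/-- The union of the unbounded components of the complement. -/
def outside (Ω : Set ℂ) : Set ℂ :=
  {z ∈ Ωᶜ | ¬ Bornology.IsBounded (connectedComponentIn Ωᶜ z)}

/-- The union of the bounded components of the complement. -/
def holes (Ω : Set ℂ) : Set ℂ :=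
  {z ∈ Ωᶜ | Bornology.IsBounded (connectedComponentIn Ωᶜ z)}

theorem connectedComponentIn_subset_holes {Ω : Set ℂ} {z : ℂ} (hz : z ∈ holes Ω) :
    connectedComponentIn Ωᶜ z ⊆ holes Ω := fun w hw =>
  ⟨connectedComponentIn_subset _ _ hw, by rw [← connectedComponentIn_eq hw]; exact hz.2⟩

theorem isClosed_connectedComponentIn {F : Set ℂ} (hF : IsClosed F) (z : ℂ) :
    IsClosed (connectedComponentIn F z) := by
  by_cases hz : z ∈ F
  · rw [connectedComponentIn_eq_image hz]
    exact hF.isClosedEmbedding_subtypeVal.isClosedMap _ isClosed_connectedComponent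
  · rw [connectedComponentIn_eq_empty hz]; exact isClosed_empty

/-- A component of the complement of an open set meets the boundary. -/
theorem exists_mem_frontier_of_notMem {Ω : Set ℂ} (hΩ : IsOpen Ω) (hne : Ω.Nonempty) {z : ℂ}
    (hz : z ∉ Ω) : ∃ w ∈ connectedComponentIn Ωᶜ z, w ∈ frontier Ω := by
  by_contra! hcon
  -- Off the boundary it would also be a component of an open set, hence clopen in the plane.
  have hsub : connectedComponentIn Ωᶜ z ⊆ (closure Ω)ᶜ := fun w hw hw' => by
    refine hcon w hw ?_
    rw [hΩ.frontier_eq]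
    exact ⟨hw', connectedComponentIn_subset _ _ hw⟩
  have hzc : z ∈ connectedComponentIn Ωᶜ z := mem_connectedComponentIn hz
  have heq : connectedComponentIn Ωᶜ z = connectedComponentIn (closure Ω)ᶜ z :=
    (isPreconnected_connectedComponentIn.subset_connectedComponentIn hzc hsub).antisymm
      (connectedComponentIn_mono z (compl_subset_compl.2 subset_closure))
  have hopen : IsOpen (connectedComponentIn Ωᶜ z) := by
    rw [heq]; exact isClosed_closure.isOpen_compl.connectedComponentIn
  have huniv := IsClopen.eq_univ ⟨isClosed_connectedComponentIn hΩ.isClosed_compl z, hopen⟩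
    ⟨z, hzc⟩
  obtain ⟨x, hx⟩ := hne
  have : x ∈ connectedComponentIn Ωᶜ z := by rw [huniv]; trivial
  exact connectedComponentIn_subset _ _ this hx

namespace IsMConnectedRegion

variable {Ω : Set ℂ} {m : ℕ} (hΩ : IsMConnectedRegion Ω m)
include hΩ

theorem exists_closedBall : ∃ R, (Metric.closedBall (0 : ℂ) R)ᶜ ⊆ outside Ω := by
  obtain ⟨R, h⟩ := hΩ.isBounded.subset_closedBall 0
  have hsub : (Metric.closedBall (0 : ℂ) R)ᶜ ⊆ Ωᶜ := compl_subset_compl.2 h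
  refine ⟨R, fun z hz => ⟨hsub hz, not_isBounded_of_compl_closedBall_subset (R := R) ?_⟩⟩
  exact (isPreconnected_compl_closedBall_zero R).subset_connectedComponentIn hz hsub

/-- Every unbounded component contains points beyond a large ball, whose exterior is connected and
disjoint from `Ω`. -/
theorem component_eq_of_outside {z w : ℂ} (hz : z ∈ outside Ω) (hw : w ∈ outside Ω) :
    connectedComponentIn Ωᶜ z = connectedComponentIn Ωᶜ w := by
  obtain ⟨R, h⟩ := hΩ.exists_closedBall
  have hsub : (Metric.closedBall (0 : ℂ) R)ᶜ ⊆ Ωᶜ := fun x hx => (h hx).1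
  have key : ∀ z ∈ outside Ω,
      ∃ x ∈ (Metric.closedBall (0 : ℂ) R)ᶜ, x ∈ connectedComponentIn Ωᶜ z := by
    intro z hz
    by_contra! hcon
    refine hz.2 ((Metric.isBounded_closedBall (x := (0 : ℂ)) (r := R)).subset fun x hx => ?_)
    by_contra hx'
    exact hcon x hx' hx
  obtain ⟨x, hx, hxz⟩ := key z hz
  obtain ⟨y, hy, hyw⟩ := key w hw
  have hxy : y ∈ connectedComponentIn Ωᶜ x :=
    (isPreconnected_compl_closedBall_zero R).subset_connectedComponentIn hx hsub hy
  rw [connectedComponentIn_eq hxz, connectedComponentIn_eq hyw, connectedComponentIn_eq hxy]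

theorem isPreconnected_outside : IsPreconnected (outside Ω) := by
  rw [isPreconnected_iff_linkedIn]
  intro x hx y hy
  refine isPreconnected_connectedComponentIn.linkedIn (C := connectedComponentIn Ωᶜ x) ?_
    (mem_connectedComponentIn hx.1) ?_
  · exact fun w hw => ⟨connectedComponentIn_subset _ _ hw, by
      rw [← connectedComponentIn_eq hw]; exact hx.2⟩
  · rw [hΩ.component_eq_of_outside hx hy]; exact mem_connectedComponentIn hy.1

theorem outside_nonempty : (outside Ω).Nonempty := by
  obtain ⟨R, h⟩ := hΩ.exists_closedBall
  refine ⟨((R + 1 : ℝ) : ℂ), h ?_⟩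
  simp only [mem_compl_iff, Metric.mem_closedBall, dist_zero_right, Complex.norm_real,
    Real.norm_eq_abs, not_le]
  exact (lt_add_one R).trans_le (le_abs_self _)

theorem isClosed_outside : IsClosed (outside Ω) := by
  obtain ⟨z, hz⟩ := hΩ.outside_nonempty
  have : outside Ω = connectedComponentIn Ωᶜ z := by
    ext w
    constructor
    · intro hw
      rw [← hΩ.component_eq_of_outside hw hz]; exact mem_connectedComponentIn hw.1
    · intro hw
      exact ⟨connectedComponentIn_subset _ _ hw, by rw [← connectedComponentIn_eq hw]; exact hz.2⟩
  rw [this]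
  exact isClosed_connectedComponentIn hΩ.isOpen.isClosed_compl z

/-- There are finitely many components, each closed; the bound on `m` serves only to make the
cardinality nonzero, hence the type finite. -/
theorem isCompact_holes (hm : 3 ≤ m) : IsCompact (holes Ω) := by
  have hfin : Finite (ConnectedComponents ↥(Ωᶜ)) :=
    Nat.finite_of_card_ne_zero (by rw [hΩ.card_components]; omega)
  have heq : holes Ω = ⋃ c : {c : ConnectedComponents ↥(Ωᶜ) //
      ((Quotient.out c : ↥(Ωᶜ)) : ℂ) ∈ holes Ω},
      connectedComponentIn Ωᶜ ((Quotient.out c.1 : ↥(Ωᶜ)) : ℂ) := by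
    ext z
    rw [mem_iUnion]
    constructor
    · intro hz
      set c : ConnectedComponents ↥(Ωᶜ) := ConnectedComponents.mk ⟨z, hz.1⟩ with hc
      have h1 : connectedComponent (Quotient.out c : ↥(Ωᶜ)) = connectedComponent ⟨z, hz.1⟩ :=
        ConnectedComponents.coe_eq_coe.1 (Quotient.out_eq c)
      have h2 : connectedComponentIn Ωᶜ ((Quotient.out c : ↥(Ωᶜ)) : ℂ) =
          connectedComponentIn Ωᶜ z := by
        rw [connectedComponentIn_eq_image (Quotient.out c : ↥(Ωᶜ)).2,
          connectedComponentIn_eq_image hz.1, ← h1]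
      refine ⟨⟨c, (Quotient.out c : ↥(Ωᶜ)).2, by rw [h2]; exact hz.2⟩, ?_⟩
      rw [h2]
      exact mem_connectedComponentIn hz.1
    · rintro ⟨⟨c, hc⟩, hz⟩
      exact connectedComponentIn_subset_holes hc hz
  have hcl : IsClosed (holes Ω) := by
    rw [heq]
    exact isClosed_iUnion_of_finite fun c =>
      isClosed_connectedComponentIn hΩ.isOpen.isClosed_compl _
  obtain ⟨R, h⟩ := hΩ.exists_closedBall
  refine (isCompact_closedBall (0 : ℂ) R).of_isClosed_subset hcl fun z hz => ?_
  by_contra hz'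
  exact (h hz').2 hz.2

theorem not_isPreconnected_holes (hm : 3 ≤ m) : ¬ IsPreconnected (holes Ω) := by
  intro hpre
  have hcard := hΩ.card_components
  -- If the holes were connected, boundedness would determine the component, and `Prop` has only two
  -- elements.
  have hinj : Function.Injective (fun c : ConnectedComponents ↥(Ωᶜ) =>
      (Bornology.IsBounded (connectedComponentIn Ωᶜ ((Quotient.out c : ↥(Ωᶜ)) : ℂ)) : Prop)) := by
    intro c d hcd
    have hcd : Bornology.IsBounded (connectedComponentIn Ωᶜ ((Quotient.out c : ↥(Ωᶜ)) : ℂ)) ↔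
      Bornology.IsBounded (connectedComponentIn Ωᶜ ((Quotient.out d : ↥(Ωᶜ)) : ℂ)) := iff_of_eq hcd
    have key : connectedComponentIn Ωᶜ ((Quotient.out c : ↥(Ωᶜ)) : ℂ) =
        connectedComponentIn Ωᶜ ((Quotient.out d : ↥(Ωᶜ)) : ℂ) := by
      by_cases hb : Bornology.IsBounded (connectedComponentIn Ωᶜ ((Quotient.out c : ↥(Ωᶜ)) : ℂ))
      · exact connectedComponentIn_eq (hpre.subset_connectedComponentIn
          ⟨(Quotient.out c : ↥(Ωᶜ)).2, hb⟩ (fun z hz => hz.1)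
          ⟨(Quotient.out d : ↥(Ωᶜ)).2, hcd.1 hb⟩)
      · exact hΩ.component_eq_of_outside ⟨(Quotient.out c : ↥(Ωᶜ)).2, hb⟩
          ⟨(Quotient.out d : ↥(Ωᶜ)).2, fun h => hb (hcd.2 h)⟩
    rw [connectedComponentIn_eq_image (Quotient.out c : ↥(Ωᶜ)).2,
      connectedComponentIn_eq_image (Quotient.out d : ↥(Ωᶜ)).2] at key
    have := Subtype.val_injective.image_injective key
    have := ConnectedComponents.coe_eq_coe.2 this
    rw [← Quotient.out_eq c, ← Quotient.out_eq d]
    exact this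
  have := Nat.card_le_card_of_injective _ hinj
  rw [hcard, Nat.card_eq_fintype_card, Fintype.card_prop] at this
  omega

theorem exists_linkedIn_innerBoundary {z : ℂ} (hz : z ∈ holes Ω) :
    ∃ w ∈ innerBoundary Ω, LinkedIn (holes Ω) z w := by
  obtain ⟨w, hw, hwf⟩ := exists_mem_frontier_of_notMem hΩ.isOpen hΩ.isConnected.nonempty hz.1
  exact ⟨w, ⟨hwf, (connectedComponentIn_subset_holes hz hw).2⟩,
    isPreconnected_connectedComponentIn.linkedIn (connectedComponentIn_subset_holes hz)
      (mem_connectedComponentIn hz.1) hw⟩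

theorem innerBoundary_nonempty (hm : 3 ≤ m) : (innerBoundary Ω).Nonempty := by
  have : (holes Ω).Nonempty := by
    by_contra h
    rw [not_nonempty_iff_eq_empty] at h
    exact hΩ.not_isPreconnected_holes hm (h ▸ isPreconnected_empty)
  obtain ⟨z, hz⟩ := this
  obtain ⟨w, hw, -⟩ := hΩ.exists_linkedIn_innerBoundary hz
  exact ⟨w, hw⟩

theorem outerBoundary_nonempty : (outerBoundary Ω).Nonempty := by
  obtain ⟨z, hz⟩ := hΩ.outside_nonempty
  obtain ⟨w, hw, hwf⟩ := exists_mem_frontier_of_notMem hΩ.isOpen hΩ.isConnected.nonempty hz.1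
  exact ⟨w, hwf, by rw [← connectedComponentIn_eq hw]; exact hz.2⟩

/-- Each hole contains a point adherent to the connected set `Ω`. -/
theorem isPreconnected_union_holes : IsPreconnected (Ω ∪ holes Ω) := by
  have key : ∀ z ∈ Ω ∪ holes Ω, ∃ w ∈ Ω, LinkedIn (Ω ∪ holes Ω) z w := by
    rintro z (hz | hz)
    · exact ⟨z, hz, LinkedIn.refl (Or.inl hz)⟩
    · obtain ⟨w, hw, hl⟩ := hΩ.exists_linkedIn_innerBoundary hz
      obtain ⟨x, hx⟩ := hΩ.isConnected.nonempty
      have hwc : w ∈ closure Ω := frontier_subset_closure hw.1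
      have h1 : IsPreconnected (insert w Ω) := hΩ.isConnected.isPreconnected.subset_closure
        (subset_insert _ _) (insert_subset hwc subset_closure)
      exact ⟨x, hx, (hl.mono subset_union_right).trans (h1.linkedIn
        (insert_subset (Or.inr hl.mem_right) subset_union_left) (mem_insert _ _)
        (mem_insert_of_mem _ hx))⟩
  rw [isPreconnected_iff_linkedIn]
  intro x hx y hy
  obtain ⟨x', hx', hl⟩ := key x hx
  obtain ⟨y', hy', hl'⟩ := key y hy
  exact (hl.trans (hΩ.isConnected.isPreconnected.linkedIn subset_union_left hx' hy')).trans hl'.symm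

end IsMConnectedRegion

/-! ### Critical levels -/

/-- The component of a bounded open sublevel set at any of its points is adherent to the
level set. -/
theorem exists_mem_closure_component {G : ℂ → ℝ} (hG : Continuous G) {t : ℝ}
    (hne : ∃ y, t ≤ G y) {x : ℂ} (hx : G x < t) :
    ∃ p, G p = t ∧ p ∈ closure (connectedComponentIn {z | G z < t} x) := by
  have hopen : IsOpen {z | G z < t} := isOpen_lt hG continuous_const
  by_contra! hcon
  -- A component not adherent to the level set is clopen, hence the whole plane.
  have hcl : IsClosed (connectedComponentIn {z | G z < t} x) := by
    refine isClosed_of_closure_subset fun p hp => ?_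
    have hle : G p ≤ t := by
      have h1 : closure (connectedComponentIn {z | G z < t} x) ⊆ {z | G z ≤ t} :=
        closure_minimal ((connectedComponentIn_subset _ _).trans fun z hz => le_of_lt (show G z < t from hz))
          (isClosed_le hG continuous_const)
      exact h1 hp
    have hlt : G p < t := lt_of_le_of_ne hle fun h => hcon p h hp
    have hmem : p ∈ connectedComponentIn {z | G z < t} p := mem_connectedComponentIn hlt
    obtain ⟨y, hy1, hy2⟩ := mem_closure_iff.1 hp _ hopen.connectedComponentIn hmem
    rw [connectedComponentIn_eq hy2, ← connectedComponentIn_eq hy1]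
    exact hmem
  have huniv := IsClopen.eq_univ ⟨hcl, hopen.connectedComponentIn⟩ ⟨x, mem_connectedComponentIn hx⟩
  obtain ⟨y, hy⟩ := hne
  have : y ∈ connectedComponentIn {z | G z < t} x := by rw [huniv]; trivial
  exact absurd (connectedComponentIn_subset _ _ this) (not_lt.2 hy)

/-- There is a critical level at which the sublevel sets become connected. -/
theorem exists_critical_level {G : ℂ → ℝ} (hG : Continuous G) {k : ℝ} (hk : 0 < k)
    (hcpt : ∀ t < k, IsCompact {z | G z ≤ t}) (hn : ¬ IsPreconnected {z | G z ≤ 0})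
    (hc : IsPreconnected {z | G z < k})
    (hmin : ∀ t, 0 < t → t ≤ k → ∀ x, G x < t → ∃ h, G h ≤ 0 ∧ LinkedIn {z | G z < t} x h) :
    ∃ t, 0 < t ∧ t < k ∧ ¬ IsPreconnected {z | G z < t} ∧
      ∀ s, t ≤ s → s < k → IsPreconnected {z | G z ≤ s} := by
  -- Every point is linked to `{G ≤ 0}`, so one connected set joining up `{G ≤ 0}` suffices.
  have hlow : ∀ t, 0 < t → t ≤ k → ∀ C, {z | G z ≤ 0} ⊆ C → C ⊆ {z | G z < t} →
      IsPreconnected C → IsPreconnected {z | G z < t} := by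
    intro t ht htk C hC hCt hCp
    rw [isPreconnected_iff_linkedIn]
    intro x hx y hy
    obtain ⟨x', hx', hl⟩ := hmin t ht htk x hx
    obtain ⟨y', hy', hl'⟩ := hmin t ht htk y hy
    exact (hl.trans (hCp.linkedIn hCt (hC hx') (hC hy'))).trans hl'.symm
  -- A compact connected set joining up `{G ≤ 0}` has maximum below `t`, so connectedness persists
  -- slightly below `t`. Hence the infimum is not attained.
  have hdown : ∀ t, 0 < t → t ≤ k → IsPreconnected {z | G z < t} →
      ∃ s, 0 < s ∧ s < t ∧ IsPreconnected {z | G z < s} := by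
    intro t ht htk hp
    obtain ⟨C, hCc, hCp, hC, hCt⟩ := exists_isCompact_isPreconnected_between
      (isOpen_lt hG continuous_const) hp (hcpt 0 hk) (fun z hz => lt_of_le_of_lt hz ht)
    have hCne : C.Nonempty := by
      by_contra h
      rw [not_nonempty_iff_eq_empty] at h
      rw [h, subset_empty_iff] at hC
      exact hn (hC ▸ isPreconnected_empty)
    obtain ⟨z₀, hz₀, hmax⟩ := hCc.exists_isMaxOn hCne hG.continuousOn
    obtain ⟨s, hs1, hs2⟩ := exists_between (max_lt ht (hCt hz₀))
    have hs0 : 0 < s := (le_max_left _ _).trans_lt hs1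
    refine ⟨s, hs0, hs2, hlow s hs0 (hs2.le.trans htk) C hC (fun z hz => ?_) hCp⟩
    exact lt_of_le_of_lt (hmax hz) ((le_max_right _ _).trans_lt hs1)
  have hup : ∀ s t, 0 < s → s ≤ t → t ≤ k → IsPreconnected {z | G z < s} →
      IsPreconnected {z | G z < t} := fun s t hs hst htk hp =>
    hlow t (hs.trans_le hst) htk _ (fun z hz => lt_of_le_of_lt hz hs)
      (fun z hz => lt_of_lt_of_le hz hst) hp
  set S := {t | 0 < t ∧ t ≤ k ∧ IsPreconnected {z | G z < t}} with hS
  have hkS : k ∈ S := ⟨hk, le_rfl, hc⟩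
  have hbdd : BddBelow S := ⟨0, fun t ht => ht.1.le⟩
  set t := sInf S with ht
  have htk : t < k := by
    obtain ⟨s, hs0, hsk, hs⟩ := hdown k hk le_rfl hc
    exact (csInf_le hbdd ⟨hs0, hsk.le, hs⟩).trans_lt hsk
  have habove : ∀ s, t < s → s ≤ k → IsPreconnected {z | G z < s} := by
    intro s hts hsk
    obtain ⟨r, hr, hrs⟩ := exists_lt_of_csInf_lt ⟨k, hkS⟩ hts
    exact hup r s hr.1 hrs.le hsk hr.2.2
  have hle : ∀ s, t ≤ s → s < k → IsPreconnected {z | G z ≤ s} := by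
    intro s hts hsk
    obtain ⟨r, hr1, hr2⟩ := exists_between hsk
    exact isPreconnected_sublevel hG hr1 (hcpt r hr2) fun q hq1 hq2 =>
      habove q (hts.trans_lt hq1) (hq2.trans hr2).le
  have ht0 : 0 < t := by
    by_contra h
    exact hn (hle 0 (not_lt.1 h) hk)
  refine ⟨t, ht0, htk, fun hp => ?_, hle⟩
  obtain ⟨s, hs0, hst, hs⟩ := hdown t ht0 htk.le hp
  exact absurd (csInf_le hbdd ⟨hs0, hst.le.trans htk.le, hs⟩) (not_le.2 hst)

/-- If a sublevel set is not connected although the level set at its boundary is connected, then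
there is a point of the level set near which the sublevel set is not locally linked. -/
theorem exists_not_locally_linked {G : ℂ → ℝ} (hG : Continuous G) {t : ℝ} (hne : ∃ y, t ≤ G y)
    (hL : IsPreconnected {z | G z = t}) (hcl : ∀ p, G p = t → p ∈ closure {z | G z < t})
    (hn : ¬ IsPreconnected {z | G z < t}) :
    ∃ p, G p = t ∧ ∀ N ∈ 𝓝 p, ∃ x ∈ N, ∃ y ∈ N, G x < t ∧ G y < t ∧
      ¬ LinkedIn {z | G z < t} x y := by
  by_contra! hcon
  refine hn (isPreconnected_iff_linkedIn.2 fun x hx y hy => ?_)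
  obtain ⟨p, hp, hpx⟩ := exists_mem_closure_component hG hne hx
  obtain ⟨q, hq, hqy⟩ := exists_mem_closure_component hG hne hy
  -- Under local linking, nearby points of the level set are adherent to the same components of the
  -- sublevel set; connectedness of the level set makes this global.
  have key : ∀ x, p ∈ closure (connectedComponentIn {z | G z < t} x) ↔
      q ∈ closure (connectedComponentIn {z | G z < t} x) := by
    refine hL.induction₂ (fun p q => ∀ x, p ∈ closure (connectedComponentIn {z | G z < t} x) ↔
      q ∈ closure (connectedComponentIn {z | G z < t} x)) ?_
      (fun _ _ _ _ _ _ h h' x => (h x).trans (h' x)) (fun _ _ _ _ h x => (h x).symm) hp hq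
    intro p hp
    obtain ⟨N, hN, hlink⟩ := hcon p hp
    have hNi : interior N ∈ 𝓝 p := interior_mem_nhds.2 hN
    filter_upwards [mem_nhdsWithin_of_mem_nhds hNi, self_mem_nhdsWithin] with q hqN hq x
    have step : ∀ a b, a ∈ interior N → b ∈ interior N → G b = t →
        a ∈ closure (connectedComponentIn {z | G z < t} x) →
        b ∈ closure (connectedComponentIn {z | G z < t} x) := by
      intro a b haN hbN hb ha
      obtain ⟨y, hyN, hy⟩ := mem_closure_iff.1 ha _ isOpen_interior haN
      rw [mem_closure_iff]
      intro o ho hbo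
      obtain ⟨w, ⟨hwo, hwN⟩, hw⟩ := mem_closure_iff.1 (hcl b hb) _ (ho.inter isOpen_interior)
        ⟨hbo, hbN⟩
      refine ⟨w, hwo, ?_⟩
      rw [← LinkedIn.iff_mem_connectedComponentIn] at hy ⊢
      exact hy.trans (hlink y (interior_subset hyN) w (interior_subset hwN) hy.mem_right hw)
    exact ⟨step p q (mem_of_mem_nhds hNi) hqN hq, step q p hqN (mem_of_mem_nhds hNi) hp⟩
  obtain ⟨N, hN, hlink⟩ := hcon p hp
  have hNi : p ∈ interior N := mem_interior_iff_mem_nhds.2 hN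
  obtain ⟨a, haN, ha⟩ := mem_closure_iff.1 hpx _ isOpen_interior hNi
  obtain ⟨b, hbN, hb⟩ := mem_closure_iff.1 ((key y).2 hqy) _ isOpen_interior hNi
  rw [← LinkedIn.iff_mem_connectedComponentIn] at ha hb
  exact (ha.trans (hlink a (interior_subset haN) b (interior_subset hbN) ha.mem_right
    hb.mem_right)).trans hb.symm

/-! ### The extension to the plane -/

open scoped Classical in
/-- The extension of a function on the closure of `Ω` to the plane by `0` on the holes of `Ω` and
by `k` outside. -/
noncomputable def planeExtension (Ω : Set ℂ) (k : ℝ) (u : ℂ → ℝ) (z : ℂ) : ℝ :=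
  if z ∈ Ω then u z else if z ∈ holes Ω then 0 else k

namespace IsMConnectedRegion

variable {Ω : Set ℂ} {m : ℕ} (hΩ : IsMConnectedRegion Ω m)

theorem planeExtension_of_mem {k : ℝ} {u : ℂ → ℝ} {z : ℂ} (hz : z ∈ Ω) :
    planeExtension Ω k u z = u z := if_pos hz

theorem planeExtension_of_mem_holes {k : ℝ} {u : ℂ → ℝ} {z : ℂ} (hz : z ∈ holes Ω) :
    planeExtension Ω k u z = 0 := by
  unfold planeExtension
  rw [if_neg hz.1, if_pos hz]

theorem planeExtension_of_mem_outside {k : ℝ} {u : ℂ → ℝ} {z : ℂ} (hz : z ∈ outside Ω) :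
    planeExtension Ω k u z = k := by
  unfold planeExtension
  rw [if_neg hz.1, if_neg fun h => hz.2 h.2]

theorem mem_cases (Ω : Set ℂ) (z : ℂ) : z ∈ Ω ∨ z ∈ holes Ω ∨ z ∈ outside Ω := by
  by_cases h : z ∈ Ω
  · exact Or.inl h
  by_cases h' : Bornology.IsBounded (connectedComponentIn Ωᶜ z)
  · exact Or.inr (Or.inl ⟨h, h'⟩)
  · exact Or.inr (Or.inr ⟨h, h'⟩)

include hΩ

theorem planeExtension_of_mem_closure {k : ℝ} {u : ℂ → ℝ} (hi : ∀ z ∈ innerBoundary Ω, u z = 0)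
    (ho : ∀ z ∈ outerBoundary Ω, u z = k) {z : ℂ} (hz : z ∈ closure Ω) :
    planeExtension Ω k u z = u z := by
  have hfr : ∀ w, w ∉ Ω → w ∈ closure Ω → w ∈ frontier Ω := fun w hw hw' => by
    rw [hΩ.isOpen.frontier_eq]; exact ⟨hw', hw⟩
  rcases mem_cases Ω z with h | h | h
  · exact planeExtension_of_mem h
  · rw [planeExtension_of_mem_holes h, hi z ⟨hfr z h.1 hz, h.2⟩]
  · rw [planeExtension_of_mem_outside h, ho z ⟨hfr z h.1 hz, h.2⟩]

/-- The closure of `Ω`, the holes and the outside are closed and cover the plane, and the boundary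
values make the pieces match. -/
theorem continuous_planeExtension (hm : 3 ≤ m) {k : ℝ} {u : ℂ → ℝ}
    (hu : ContinuousOn u (closure Ω)) (hi : ∀ z ∈ innerBoundary Ω, u z = 0)
    (ho : ∀ z ∈ outerBoundary Ω, u z = k) : Continuous (planeExtension Ω k u) := by
  rw [← continuousOn_univ]
  have hcov : (univ : Set ℂ) = closure Ω ∪ (holes Ω ∪ outside Ω) := by
    refine (eq_univ_of_forall fun z => ?_).symm
    rcases mem_cases Ω z with h | h | h
    exacts [Or.inl (subset_closure h), Or.inr (Or.inl h), Or.inr (Or.inr h)]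
  rw [hcov]
  have hH := (hΩ.isCompact_holes hm).isClosed
  refine ContinuousOn.union_of_isClosed ?_ (ContinuousOn.union_of_isClosed ?_ ?_ hH
    hΩ.isClosed_outside) isClosed_closure (hH.union hΩ.isClosed_outside)
  · exact hu.congr fun z hz => hΩ.planeExtension_of_mem_closure hi ho hz
  · exact continuousOn_const.congr fun z hz => planeExtension_of_mem_holes hz
  · exact continuousOn_const.congr fun z hz => planeExtension_of_mem_outside hz

end IsMConnectedRegion

/-! ### The critical level curve: existence and uniqueness. -/

open IsMConnectedRegion CellDecomposition in
theorem mainTheorem7 {Ω : Set ℂ} {m : ℕ} (hΩ : IsMConnectedRegion Ω m) (hm : 3 ≤ m)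
    (T : CellDecomposition Ω)
    (c : T.V → T.V → ℝ) (hc : T.IsConductance c)
    (k : ℝ) (hk : 0 < k)
    (g : T.V → ℝ) (hg : T.IsDirichletSolution c k g) (hsep : T.SeparatesAdjacent g)
    (gbar : ℂ → ℝ) (hgbar : T.IsAffineExtension g gbar) :
    ∃! L : Set ℂ, T.IsSingularLevelCurve g gbar L ∧ innerBoundary Ω ⊆ enclosedDomain L := by
  have hop := hΩ.isOpen
  -- the data on the closure of the region
  have hi : ∀ z ∈ innerBoundary Ω, gbar z = 0 := fun z hz => hg.apply_inner hgbar hop hz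
  have ho : ∀ z ∈ outerBoundary Ω, gbar z = k := fun z hz => hg.apply_outer hgbar hop hz
  have hh : T.HasHigherNeighbors g := hasHigherNeighbors_of_harmonic hop hc hsep hg.harmonic
  have hl : T.HasHigherNeighbors (-g) := hasHigherNeighbors_of_harmonic hop hc hsep.neg
    fun x hx => by rw [T.laplacian_neg, hg.harmonic x hx, neg_zero]
  have hnc : ∀ f, ∃ i j, g (T.vtx f i) ≠ g (T.vtx f j) := by
    obtain ⟨x, hx⟩ := hΩ.innerBoundary_nonempty hm
    obtain ⟨y, hy⟩ := hΩ.outerBoundary_nonempty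
    exact hgbar.exists_ne_corner hop hΩ.isConnected.isPreconnected hsep
      ⟨x, frontier_subset_closure hx.1, y, frontier_subset_closure hy.1, by
        rw [hi x hx, ho y hy]; exact hk.ne⟩
  have hnc' : ∀ f, ∃ i j, (-g) (T.vtx f i) ≠ (-g) (T.vtx f j) := fun f => by
    obtain ⟨i, j, hij⟩ := hnc f
    exact ⟨i, j, fun h => hij (neg_injective h)⟩
  have hbdry : ∀ u : T.V, (u : ℂ) ∉ Ω →
      ((u : ℂ) ∈ outside Ω ∧ g u = k) ∨ ((u : ℂ) ∈ innerBoundary Ω ∧ g u = 0) := by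
    intro u hu
    have hf : (u : ℂ) ∈ frontier Ω := by rw [hop.frontier_eq]; exact ⟨T.vertex_mem u, hu⟩
    by_cases hb : Bornology.IsBounded (connectedComponentIn Ωᶜ (u : ℂ))
    · exact Or.inr ⟨⟨hf, hb⟩, hg.inner u ⟨hf, hb⟩⟩
    · exact Or.inl ⟨⟨hu, hb⟩, hg.outer u ⟨hf, hb⟩⟩
  have hup : ∀ z ∈ Ω, z ∈ closure {w ∈ closure Ω | gbar z < gbar w} := fun z hz =>
    hgbar.mem_closure_gt hop hh hsep hnc hz
  have hdown : ∀ z ∈ Ω, z ∈ closure {w ∈ closure Ω | gbar w < gbar z} := fun z hz => by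
    simpa using hgbar.neg.mem_closure_gt hop hl hsep.neg hnc' hz
  have hreach : ∀ t, ∀ z ∈ closure Ω, t < gbar z →
      ∃ u : T.V, (u : ℂ) ∉ Ω ∧ LinkedIn {w ∈ closure Ω | t < gbar w} z u :=
    fun t z hz h => hgbar.exists_linkedIn_vertex hh hz h
  have hreach' : ∀ t, ∀ z ∈ closure Ω, gbar z < t →
      ∃ u : T.V, (u : ℂ) ∉ Ω ∧ LinkedIn {w ∈ closure Ω | gbar w < t} z u := fun t z hz h => by
    simpa using hgbar.neg.exists_linkedIn_vertex (t := -t) hl hz (neg_lt_neg h)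
  -- Near a point at level `k` or above there is a strictly higher one, linked above `k` to a
  -- boundary vertex, whose value is `0` or `k`.
  have hltk : ∀ z ∈ Ω, gbar z < k := by
    intro z hz
    by_contra! hcon
    obtain ⟨w, hw, hlt⟩ := closure_nonempty_iff.1 ⟨z, hup z hz⟩
    obtain ⟨u, hu, hlink⟩ := hreach k w hw (hcon.trans_lt hlt)
    have h1 := hlink.mem_right.2
    rw [hgbar.vertex] at h1
    rcases hbdry u hu with ⟨-, h⟩ | ⟨-, h⟩ <;> linarith
  have hpos : ∀ z ∈ Ω, 0 < gbar z := by
    intro z hz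
    by_contra! hcon
    obtain ⟨w, hw, hlt⟩ := closure_nonempty_iff.1 ⟨z, hdown z hz⟩
    obtain ⟨u, hu, hlink⟩ := hreach' 0 w hw (hlt.trans_le hcon)
    have h1 := hlink.mem_right.2
    rw [hgbar.vertex] at h1
    rcases hbdry u hu with ⟨-, h⟩ | ⟨-, h⟩ <;> linarith
  -- the extension to the plane
  set G := planeExtension Ω k gbar with hGdef
  have hGe : ∀ z ∈ closure Ω, G z = gbar z := fun z hz => hΩ.planeExtension_of_mem_closure hi ho hz
  have hGΩ : ∀ z ∈ Ω, G z = gbar z := fun z hz => hGe z (subset_closure hz)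
  have hGH : ∀ z ∈ holes Ω, G z = 0 := fun z hz => planeExtension_of_mem_holes hz
  have hGO : ∀ z ∈ outside Ω, G z = k := fun z hz => planeExtension_of_mem_outside hz
  have hG : Continuous G := hΩ.continuous_planeExtension hm hgbar.continuousOn hi ho
  have hIH : innerBoundary Ω ⊆ holes Ω := fun z hz => by
    refine ⟨?_, hz.2⟩
    have := hz.1
    rw [hop.frontier_eq] at this
    exact this.2
  have hzero : {z | G z ≤ 0} = holes Ω := by
    ext z
    refine ⟨fun h => ?_, fun h => (hGH z h).le⟩
    have h : G z ≤ 0 := h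
    rcases mem_cases Ω z with h' | h' | h'
    · rw [hGΩ z h'] at h; exact absurd (hpos z h') (not_lt.2 h)
    · exact h'
    · rw [hGO z h'] at h; exact absurd hk (not_lt.2 h)
  have hltk' : {z | G z < k} = Ω ∪ holes Ω := by
    ext z
    constructor
    · intro h
      have h : G z < k := h
      rcases mem_cases Ω z with h' | h' | h'
      · exact Or.inl h'
      · exact Or.inr h'
      · exact absurd (hGO z h') h.ne
    · rintro (h' | h')
      · exact (hGΩ z h').trans_lt (hltk z h')
      · exact (hGH z h').trans_lt hk
  have hmemΩ : ∀ z, 0 < G z → G z < k → z ∈ Ω := by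
    intro z h1 h2
    rcases mem_cases Ω z with h' | h' | h'
    · exact h'
    · exact absurd (hGH z h') h1.ne'
    · exact absurd (hGO z h') h2.ne
  obtain ⟨R, hR⟩ := hΩ.exists_closedBall
  have hball : ∀ t < k, {z | G z ≤ t} ⊆ Metric.closedBall 0 R := by
    intro t ht z hz
    by_contra hcon
    have hz : G z ≤ t := hz
    rw [hGO z (hR hcon)] at hz
    linarith
  have hcpt : ∀ t < k, IsCompact {z | G z ≤ t} := fun t ht =>
    (isCompact_closedBall (0 : ℂ) R).of_isClosed_subset (isClosed_le hG continuous_const)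
      (hball t ht)
  have hgt : ∀ t, 0 < t → t < k → IsPreconnected {z | t < G z} := by
    intro t ht htk
    have hO : outside Ω ⊆ {z | t < G z} := fun z hz => htk.trans_eq (hGO z hz).symm
    have key : ∀ z, t < G z → ∃ y ∈ outside Ω, LinkedIn {z | t < G z} z y := by
      intro z hz
      rcases mem_cases Ω z with h' | h' | h'
      · rw [hGΩ z h'] at hz
        obtain ⟨u, hu, hlink⟩ := hreach t z (subset_closure h') hz
        have h1 := hlink.mem_right.2
        rw [hgbar.vertex] at h1
        rcases hbdry u hu with ⟨h2, -⟩ | ⟨-, h2⟩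
        · refine ⟨u, h2, hlink.mono ?_⟩
          rintro w ⟨hw, hwt⟩
          exact hwt.trans_eq (hGe w hw).symm
        · linarith
      · rw [hGH z h'] at hz; linarith
      · exact ⟨z, h', LinkedIn.refl hz⟩
    rw [isPreconnected_iff_linkedIn]
    intro x hx y hy
    obtain ⟨x', hx', hlx⟩ := key x hx
    obtain ⟨y', hy', hly⟩ := key y hy
    exact (hlx.trans (hΩ.isPreconnected_outside.linkedIn hO hx' hy')).trans hly.symm
  -- No point of `Ω` is a local maximum, so this set lies between `{t < G}` and its closure.
  have hge : ∀ t, 0 < t → t < k → IsPreconnected {z | t ≤ G z} := by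
    intro t ht htk
    refine (hgt t ht htk).subset_closure (fun z hz => le_of_lt (show t < G z from hz)) ?_
    intro z hz
    rcases (show t ≤ G z from hz).lt_or_eq with h | h
    · exact subset_closure h
    · have hzΩ := hmemΩ z (by linarith) (by linarith)
      refine closure_mono ?_ (hup z hzΩ)
      rintro w ⟨hw, hwt⟩
      rw [← hGΩ z hzΩ, ← hGe w hw, ← h] at hwt
      exact hwt
  have hlt : ∀ t, 0 < t → t ≤ k → ∀ x, G x < t →
      ∃ h ∈ innerBoundary Ω, LinkedIn {z | G z < t} x h := by
    intro t ht htk x hx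
    have hH : holes Ω ⊆ {z | G z < t} := fun z hz => (hGH z hz).trans_lt ht
    rcases mem_cases Ω x with h' | h' | h'
    · rw [hGΩ x h'] at hx
      obtain ⟨u, hu, hlink⟩ := hreach' t x (subset_closure h') hx
      have h1 := hlink.mem_right.2
      rw [hgbar.vertex] at h1
      rcases hbdry u hu with ⟨-, h2⟩ | ⟨h2, -⟩
      · linarith
      · refine ⟨u, h2, hlink.mono ?_⟩
        rintro w ⟨hw, hwt⟩
        exact (hGe w hw).trans_lt hwt
    · obtain ⟨w, hw, hlink⟩ := hΩ.exists_linkedIn_innerBoundary h'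
      exact ⟨w, hw, hlink.mono hH⟩
    · rw [hGO x h'] at hx; linarith
  -- the critical level
  obtain ⟨t, ht0, htk, hnt, hpre⟩ := exists_critical_level hG hk hcpt
    (by rw [hzero]; exact hΩ.not_isPreconnected_holes hm)
    (by rw [hltk']; exact hΩ.isPreconnected_union_holes)
    (fun t ht htk x hx => by
      obtain ⟨h, hh, hlink⟩ := hlt t ht htk x hx
      exact ⟨h, (hGH h (hIH hh)).le, hlink⟩)
  obtain ⟨o, hoO⟩ := hΩ.outside_nonempty
  have hto : ∃ y, t ≤ G y := ⟨o, by rw [hGO o hoO]; exact htk.le⟩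
  have hL : IsPreconnected {z | G z = t} := by
    have := isPreconnected_inter_of_union_eq_univ (isClosed_le hG continuous_const)
      (isClosed_le continuous_const hG) (hpre t le_rfl htk) (hge t ht0 htk)
      (eq_univ_of_forall fun z => le_total (G z) t)
    convert this using 1
    ext z
    exact le_antisymm_iff
  have hlevel : ∀ s, 0 < s → s < k → {w ∈ closure Ω | gbar w = s} = {z | G z = s} := by
    intro s hs hsk
    ext z
    constructor
    · rintro ⟨h1, h2⟩
      exact (hGe z h1).trans h2
    · intro h
      have h : G z = s := h
      have hz := hmemΩ z (by linarith) (by linarith)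
      exact ⟨subset_closure hz, (hGΩ z hz).symm.trans h⟩
  obtain ⟨v, hvt, hvs⟩ : ∃ v : T.V, G v = t ∧ T.IsSingularVertex g v := by
    obtain ⟨p, hp, hpN⟩ := exists_not_locally_linked hG hto hL (fun p hp => by
      have hpΩ := hmemΩ p (by linarith) (by linarith)
      refine closure_mono ?_ (hdown p hpΩ)
      rintro w ⟨hw, hwt⟩
      rw [← hGΩ p hpΩ, ← hGe w hw, hp] at hwt
      exact hwt) hnt
    by_contra! hcon
    have hpΩ := hmemΩ p (by linarith) (by linarith)
    obtain ⟨N, hN, hlink⟩ := hgbar.eventually_linkedIn hop hsep hpΩ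
      fun v hv => hcon v (by rw [hv, hp])
    obtain ⟨x, hx, y, hy, hxt, hyt, hxy⟩ := hpN (N ∩ Ω) (inter_mem hN (hop.mem_nhds hpΩ))
    rw [← hGΩ p hpΩ, hp] at hlink
    refine hxy ((hlink x hx.1 y hy.1 (subset_closure hx.2) (subset_closure hy.2)
      (by rwa [← hGΩ x hx.2]) (by rwa [← hGΩ y hy.2])).mono ?_)
    rintro w ⟨hw, hwt⟩
    exact (hGe w hw).trans_lt hwt
  have hbd : Bornology.IsBounded {z | G z < t} :=
    (Metric.isBounded_closedBall (x := (0 : ℂ)) (r := R)).subset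
      fun z hz => hball t htk (le_of_lt (show G z < t from hz))
  refine ⟨{z | G z = t}, ⟨⟨⟨v, subset_closure hvs.1, ?_⟩, v, hvs, hvt⟩, ?_⟩, ?_⟩
  · rw [← hGΩ v hvs.1, hvt, hlevel t ht0 htk, hL.connectedComponentIn hvt]
  · intro z hz
    have hz0 : G z = 0 := hGH z (hIH hz)
    have hzL : z ∈ {z | G z = t}ᶜ := fun h => ht0.ne (hz0.symm.trans h)
    refine ⟨hzL, hbd.subset fun w hw => ?_⟩
    by_contra hcon
    have hwL : G w ≠ t := connectedComponentIn_subset _ _ hw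
    have hwt : t < G w := lt_of_le_of_ne (not_lt.1 hcon) hwL.symm
    -- A component of `{G ≠ t}` starting in a hole cannot pass from `{G < t}` to `{G > t}`.
    obtain ⟨x, -, hx1, hx2⟩ := isPreconnected_connectedComponentIn
      (x := z) (F := {z | G z = t}ᶜ) {z | G z < t} {z | t < G z} (isOpen_lt hG continuous_const)
      (isOpen_lt continuous_const hG) (fun y hy => lt_or_gt_of_ne
        (show G y ≠ t from connectedComponentIn_subset _ _ hy))
      ⟨z, mem_connectedComponentIn hzL, hz0.trans_lt ht0⟩ ⟨w, hw, hwt⟩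
    exact lt_asymm (show G x < t from hx1) hx2
  · rintro L' ⟨⟨⟨z, hz, hL'⟩, v', hv', hvL'⟩, henc⟩
    have hvz : gbar v' = gbar z := by
      rw [hL'] at hvL'; exact (connectedComponentIn_subset _ _ hvL').2
    set t' := gbar z with ht'
    have ht'0 : 0 < t' := by rw [← hvz]; exact hpos _ hv'.1
    have ht'k : t' < k := by rw [← hvz]; exact hltk _ hv'.1
    rw [hlevel t' ht'0 ht'k] at hL'
    have hvt' : G v' = t' := (hGΩ _ hv'.1).trans hvz
    have hgv : g v' = t' := (hgbar.vertex v').symm.trans hvz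
    have hL'v : L' = connectedComponentIn {z | G z = t'} (v' : ℂ) := by
      rw [hL'] at hvL' ⊢; exact connectedComponentIn_eq hvL'
    rcases lt_trichotomy t' t with hlt' | heq | hgt'
    · exfalso
      have hL'sub : ∀ x ∈ L', G x = t' := fun x hx => by
        rw [hL'v] at hx; exact connectedComponentIn_subset {z | G z = t'} _ hx
      have hL'lt : L' ⊆ {z | G z < t} := fun x hx => (hL'sub x hx).trans_lt hlt'
      have cL' : IsPreconnected L' := by rw [hL'v]; exact isPreconnected_connectedComponentIn
      -- `L'` lies in the component of `v'` in `{G < t}`; another component exists and contains an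
      -- inner boundary point `h`.
      obtain ⟨y, hy, hny⟩ : ∃ y, G y < t ∧ ¬ LinkedIn {z | G z < t} (v' : ℂ) y := by
        by_contra! hcon
        exact hnt (isPreconnected_iff_linkedIn.2 fun x hx y hy => (hcon x hx).symm.trans (hcon y hy))
      obtain ⟨h, hhI, hlink⟩ := hlt t ht0 htk.le y hy
      have hht : G h < t := hlink.mem_right
      obtain ⟨p, hp, hpc⟩ := exists_mem_closure_component hG hto hht
      set C := connectedComponentIn {z | G z < t} h with hC
      have hCL' : ∀ x ∈ C, x ∉ L' := by
        intro x hx hxL'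
        refine hny ((cL'.linkedIn hL'lt hvL' hxL').trans ?_)
        exact (LinkedIn.iff_mem_connectedComponentIn.2 hx).symm.trans hlink.symm
      have c1 : IsPreconnected (insert p C) := isPreconnected_connectedComponentIn.subset_closure
        (subset_insert _ _) (insert_subset hpc subset_closure)
      -- Through `p` the component of `h` is joined to the unbounded set `{t ≤ G}` without meeting
      -- `L'`, so `L'` does not enclose `h`.
      have c2 : IsPreconnected (insert p C ∪ {z | t ≤ G z}) :=
        c1.union p (mem_insert _ _) hp.ge (hge t ht0 htk)
      have hsub : insert p C ∪ {z | t ≤ G z} ⊆ L'ᶜ := by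
        rintro x ((rfl | hx) | hx) hxL'
        · linarith [hL'sub _ hxL']
        · exact hCL' x hx hxL'
        · have hx : t ≤ G x := hx
          linarith [hL'sub _ hxL']
      have hmem : h ∈ insert p C ∪ {z | t ≤ G z} :=
        Or.inl (mem_insert_of_mem _ (mem_connectedComponentIn hht))
      have := c2.subset_connectedComponentIn hmem hsub
      refine not_isBounded_of_compl_closedBall_subset (R := R) ?_ (henc hhI).2
      exact fun x hx => this (Or.inr (htk.le.trans_eq (hGO x (hR hx)).symm))
    · rw [hL'v, heq]
      exact hL.connectedComponentIn (hvt'.trans heq)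
    · exfalso
      -- From the critical level up to `g v'`, the closed sublevel sets are connected.
      refine hgbar.not_isSingularVertex hop hsep hh hl hGe (v := v') (s₀ := t) (by rwa [hgv])
        ?_ ?_ ?_ ?_ hv'
      · intro x hx
        rcases mem_cases Ω x with h' | h' | h'
        · exact absurd h' hx
        · exact Or.inl (by rw [hGH x h']; exact ht0.le)
        · exact Or.inr (by rw [hGO x h', hgv]; exact ht'k)
      · intro s _ hs
        exact hcpt s (hs.trans (by rwa [hgv]))
      · intro s hs hs'
        exact hpre s hs (hs'.trans (by rwa [hgv]))
      · rw [hgv]; exact hgt t' ht'0 ht'k
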